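/- **Proposition 3.11.** Write $\langle\cdot,\cdot\rangle$ for the scalar product of $\mathbb C^2$, linear in the first variable, and let $H^+=H^2(\mathbb D;\mathbb C^2)$ be the Hardy space, regarded through boundary values as a subspace of $L^2(\partial\mathbb D;\mathbb C^2)$ (normalized Lebesgue measure). Fix $B>0$. A family $\{\mathfrak h_l\}_{l\ge 0}\subset H^+$ carries vectors $\Psi_n\in\mathbb C^2$ $(n\ge1)$, defined by $$\mathfrak h_0(\omega)=\sum_{k\ge0}\omega^k\Psi_{2^k},\qquad \mathfrak h_l(\omega)=\sum_{k\ge0}\omega^k\Psi_{2^{p+k+1}+l}\quad(l\ge1,\ 2^p\le l<2^{p+1}).$$ For $l\ge1$ with $2^p\le l<2^{p+1}$ and $0\le j\le p$ put $l|_j:=2^j+(l \bmod 2^j)$. Consider the conditions $$(\mathrm{h1})\qquad \langle\omega^m\mathfrak h_{l'},\omega^n\mathfrak h_l\rangle_{H^+}=\delta_{m-n}\,\beta_{l,l'}\qquad(l,l',m,n\ge0),$$ where $\beta_{0,0}=B$; $\beta_{0,l'}=\beta_{l',0}=0$ for $l'\ge1$; $\beta_{l,l}=B-\sum_{j=0}^{p}\|\Psi_{l|_j}\|^2$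 for $l\ge1$; and, for $l\ne l'$, $l,l'\ge1$, $2^p\le l<2^{p+1}$, $2^{p'}\le l'<2^{p'+1}$, $$\beta_{l,l'}=-\sum_{s}\langle\Psi_{l'|_{p'-s}},\Psi_{l|_{p-s}}\rangle ,$$ the sum being over those $0\le s\le\min(p,p')$ with $\lfloor l/2^{p-s}\rfloor=\lfloor l'/2^{p'-s}\rfloor$. Then $\{\mathfrak h_l\}_{l\ge0}$ satisfies (h1) if and only if it is of one of the following five types (equalities hold for a.e. $\omega\in\partial\mathbb D$). * **Type 1.** There are $u_0\in\mathbb C^2$ with $\|u_0\|=1$ and $B_0\in\mathbb C$ with $|B_0|^2=B$ such that $\mathfrak h_0(\omega)=B_0u_0$ and $\mathfrak h_l=0$ for $l\ge1$. * **Type 2.** There are an orthonormal basis $\{u_0,u_1\}$ of $\mathbb C^2$ and $B_0,C_1\in\mathbb C$ with $|B_0|^2=|C_1|^2=B$ such that $\mathfrak h_0(\omega)=\omega B_0u_0$, $\mathfrak h_1(\omega)=C_1u_1$, and $\mathfrak h_l=0$ for $l\ge2$. * **Type 3.** There are an orthonormal basis $\{u_0,u_1\}$ of $\mathbb C^2$,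 $0<\rho<1$, $\theta\in\mathbb R$ and $B_0,C_1\in\mathbb C$ with $|B_0|^2=B$, $|C_1|^2=B(1-\rho^2)$ such that $$\mathfrak h_0(\omega)=B_0\big(\rho u_0+\omega(1-\rho^2)^{1/2}u_1\big),\qquad \mathfrak h_1(\omega)=C_1e^{i\theta}\big[(1-\rho^2)^{1/2}u_0-\omega\rho u_1\big],$$ $$\mathfrak h_{2^p-1}(\omega)=\Big(-\frac{\overline{B_0}\,\rho(1-\rho^2)^{1/2}e^{i\theta}}{\overline{C_1}}\Big)^{p-1}C_1e^{i\theta}\big[(1-\rho^2)^{1/2}u_0-\omega\rho u_1\big]\quad(p>1),$$ and $\mathfrak h_l=0$ for all other $l\ge1$. * **Type 4.** There are an orthonormal basis $\{u_0,u_1\}$ of $\mathbb C^2$, $0<\rho<1$, $\theta\in\mathbb R$ and $B_0,C_1\in\mathbb C$ with $|B_0|^2=B$, $|C_1|^2=B(1-\rho^2)$ such that $$\mathfrak h_0(\omega)=B_0\Big(1+\frac{1-\rho^2}{\rho}e^{i\theta}\sum_{k\ge1}\omega^k(-\rho e^{i\theta})^{k-1}\Big)\rho u_0,\qquad \mathfrak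 h_1(\omega)=C_1u_1,$$ $$\mathfrak h_{2^p}(\omega)=\frac{B}{\overline{C_1}}(-\rho e^{i\theta})^p(1-\rho^2)u_1\quad(p>0),$$ and $\mathfrak h_l=0$ for all other $l\ge1$. * **Type 5.** There are $\rho_0\in\mathbb C$ with $0<|\rho_0|<1$ and, with $\kappa=\frac{|\rho_0|^2}{1-|\rho_0|^2}$, unit vectors $u_0,u_1,v\in\mathbb C^2$ with $\langle u_0,v\rangle\neq0$ and $$\kappa\,\langle u_0,u_1\rangle\langle v,u_0\rangle+\langle v,u_1\rangle=0,$$ numbers $\rho_1,\tau_0\in\mathbb C$ with $$|\rho_1|^2=\frac{1-|\rho_0|^2}{1+\kappa|\langle v,u_0\rangle|^2},\qquad |\tau_0|^2=\frac1{1+\kappa|\langle u_1,u_0\rangle|^2},$$ and $B_0,C_1\in\mathbb C$ with $|B_0|^2=B$, $|C_1|^2=B(1-|\rho_0|^2)$, such that, putting $$r=-\frac{\overline{\rho_0}}{\overline{\rho_1}}\,\frac{\langle v,u_0\rangle}{1+\kappa|\langle v,u_0\rangle|^2},\qquad \tau_1=\tau_0\,\frac{\rho_1\langle u_1,v\rangle}{\rho_0\langle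 u_0,v\rangle},$$ one has $$\mathfrak h_0(\omega)=B_0\Big(\rho_0u_0+\rho_1v\sum_{k\ge1}\omega^kr^{k-1}\Big),\qquad \mathfrak h_1(\omega)=C_1\Big(\tau_0u_1+\tau_1v\sum_{k\ge1}\omega^kr^{k-1}\Big),\qquad \mathfrak h_l=\frac{C_l}{C_1}\mathfrak h_1\quad(l\ge1),$$ where, for $p>0$, $$C_{2^p}=\frac{B}{\overline{C_1}}(1-|\rho_0|^2)r^p,\qquad C_{2^p+1}=\frac{C_1\overline{B_0}}{\overline{C_1}}\,\frac{\tau_1}{\rho_1}(1-|\rho_0|^2)r^{p-1},$$ and, for every other $l=2^{p_0}+2^{p_1}+\dots+2^{p_s}$ with $p_0>p_1>\dots>p_s\ge0$, $s\ge1$, $$C_l=\begin{cases}C_1^{-(s-1)}\prod_{i=1}^{s}C_{2^{p_{i-1}-p_i}+1},&p_s=0,\\[1ex] C_1^{-s}\Big(\prod_{i=1}^{s}C_{2^{p_{i-1}-p_i}+1}\Big)C_{2^{p_s}},&p_s>0.\end{cases}$$ -/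

import Mathlib

open MeasureTheory AddCircle
open scoped ComplexConjugate

noncomputable section

/-- The Hilbert space `ℂ²`. -/
abbrev C2 : Type := EuclideanSpace ℂ (Fin 2)

/-- The scalar product of `ℂ²`, linear in the first and conjugate-linear in the second variable
(Mathlib's `inner` is conjugate-linear in the first one). -/
def ip (x y : C2) : ℂ := inner ℂ y x

/-- The point `ω = exp (2 π i t)` of the unit circle `∂𝔻`, parametrized by `t ∈ ℝ / ℤ`. -/
def om (t : UnitAddCircle) : ℂ := (toCircle t : ℂ)

/-- `L²(∂𝔻; ℂ²)`, with respect to the normalized Lebesgue measure of the circle. -/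
abbrev L2Circle : Type := Lp C2 2 (haarAddCircle : Measure UnitAddCircle)

/-- The Hardy space `H⁺(∂𝔻; ℂ²)`, i.e. `H²(𝔻; ℂ²)` regarded through boundary values as a subspace
of `L²(∂𝔻; ℂ²)`: the functions whose Fourier coefficients of negative index vanish, that is,
`𝔥(ω) = ∑_{k ≥ 0} ω ^ k h_k` with `∑ ‖h_k‖² < ∞`. -/
def Hardy : Submodule ℂ L2Circle where
  carrier := {f | ∀ n : ℤ, n < 0 → fourierCoeff (f : UnitAddCircle → C2) n = 0}
  zero_mem' := by
    intro n _
    have h0 : ((0 : L2Circle) : UnitAddCircle → C2) =ᵐ[haarAddCircle] 0 := Lp.coeFn_zero _ _ _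
    unfold fourierCoeff
    rw [integral_congr_ae (g := fun _ => (0 : C2))]
    · simp
    · filter_upwards [h0] with t ht
      simp
  add_mem' := by
    intro f g hf hg n hn
    have hfi : Integrable (f : UnitAddCircle → C2) haarAddCircle :=
      (Lp.memLp f).integrable (by norm_num)
    have hgi : Integrable (g : UnitAddCircle → C2) haarAddCircle :=
      (Lp.memLp g).integrable (by norm_num)
    have h1 : fourierCoeff ((f + g : L2Circle) : UnitAddCircle → C2) n =
        fourierCoeff ((f : UnitAddCircle → C2) + (g : UnitAddCircle → C2)) n := by
      unfold fourierCoeff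
      apply integral_congr_ae
      filter_upwards [Lp.coeFn_add f g] with t ht
      rw [ht]
    rw [h1, fourierCoeff.add hfi hgi, Pi.add_apply, hf n hn, hg n hn, add_zero]
  smul_mem' := by
    intro c f hf n hn
    have h1 : fourierCoeff ((c • f : L2Circle) : UnitAddCircle → C2) n =
        fourierCoeff (c • (f : UnitAddCircle → C2)) n := by
      unfold fourierCoeff
      apply integral_congr_ae
      filter_upwards [Lp.coeFn_smul c f] with t ht
      rw [ht]
    rw [h1, fourierCoeff.const_smul, hf n hn, smul_zero]

/-- The boundary function `ω ↦ 𝔥(ω)` of an element of the Hardy space. -/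
def bd (f : Hardy) : UnitAddCircle → C2 := ((f : L2Circle) : UnitAddCircle → C2)

/-- The `k`-th Taylor coefficient `h_k` of `𝔥(ω) = ∑_{k ≥ 0} ω ^ k h_k`. -/
def taylor (f : Hardy) (k : ℕ) : C2 := fourierCoeff (bd f) (k : ℤ)

/-- `𝔥` is the Hardy function given by the formula `F`, as a function of `ω ∈ ∂𝔻` (a.e.). -/
def EqFun (f : Hardy) (F : ℂ → C2) : Prop :=
  ∀ᵐ t ∂(haarAddCircle : Measure UnitAddCircle), bd f t = F (om t)

/-- The scalar product `⟨ω ^ m f(ω), ω ^ n g(ω)⟩` of `H⁺(∂𝔻; ℂ²)`. -/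
def shiftIp (m : ℕ) (f : Hardy) (n : ℕ) (g : Hardy) : ℂ :=
  ∫ t, ip (om t ^ m • bd f t) (om t ^ n • bd g t) ∂(haarAddCircle : Measure UnitAddCircle)

/-- The vectors `Ψ_n ∈ ℂ²` carried by a family `{𝔥_l}`: they are determined by
`𝔥_0(ω) = ∑_k ω ^ k Ψ_{2 ^ k}` and, for `l ≥ 1` with leading binary digit `2 ^ p`,
`𝔥_l(ω) = ∑_k ω ^ k Ψ_{2 ^ (p + k + 1) + l}` (see `Psi_two_pow` and `Psi_add`);
moreover `Ψ_0 = 0`. -/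
def Psi (h : ℕ → Hardy) (n : ℕ) : C2 :=
  if n = 0 then 0
  else if n = 2 ^ Nat.log 2 n then taylor (h 0) (Nat.log 2 n)
  else taylor (h (n - 2 ^ Nat.log 2 n)) (Nat.log 2 n - Nat.log 2 (n - 2 ^ Nat.log 2 n) - 1)

theorem Psi_two_pow (h : ℕ → Hardy) (k : ℕ) : Psi h (2 ^ k) = taylor (h 0) k := by
  have h1 : Nat.log 2 (2 ^ k) = k := Nat.log_pow (by norm_num) k
  simp [Psi, h1]

theorem Psi_add (h : ℕ → Hardy) (l k : ℕ) (hl : 1 ≤ l) :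
    Psi h (2 ^ (Nat.log 2 l + k + 1) + l) = taylor (h l) k := by
  have hlt : l < 2 ^ (Nat.log 2 l + k + 1) :=
    lt_of_lt_of_le (Nat.lt_pow_succ_log_self (by norm_num) l)
      (Nat.pow_le_pow_right (by norm_num) (by omega))
  have h1 : Nat.log 2 (2 ^ (Nat.log 2 l + k + 1) + l) = Nat.log 2 l + k + 1 := by
    apply Nat.log_eq_of_pow_le_of_lt_pow
    · omega
    · rw [pow_succ 2 (Nat.log 2 l + k + 1)]
      omega
  have h2 : Nat.log 2 l + k + 1 - Nat.log 2 l - 1 = k := by omega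
  have h3 : ¬ (2 ^ (Nat.log 2 l + k + 1) + l = 0) := by omega
  have h4 : ¬ (2 ^ (Nat.log 2 l + k + 1) + l = 2 ^ (Nat.log 2 l + k + 1)) := by omega
  unfold Psi
  rw [h1, if_neg h3, if_neg h4, Nat.add_sub_cancel_left, h2]

/-- For `l = ∑ l_t 2 ^ t`, the number `2 ^ j + ∑_{t < j} l_t 2 ^ t`. -/
def trunc (l j : ℕ) : ℕ := 2 ^ j + l % 2 ^ j

/-- The numbers `β_{l,l'}`. Here `p = Nat.log 2 l` and `p' = Nat.log 2 l'` are the exponents of the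
leading binary digits, the summation index is `s = -k`, and `l / 2 ^ (p - s)` is the number
`∑_{t = 0}^{s} l_{p - s + t} 2 ^ t` made of the `s + 1` leading binary digits of `l`.
The value `0` for `l ≥ 1`, `l' = 0` is the one forced by Hermitian symmetry. -/
def beta (B : ℝ) (h : ℕ → Hardy) (l l' : ℕ) : ℂ :=
  if l = 0 ∧ l' = 0 then (B : ℂ)
  else if l = 0 ∨ l' = 0 then 0
  else if l = l' then
    ((B - ∑ j ∈ Finset.range (Nat.log 2 l + 1), ‖Psi h (trunc l j)‖ ^ 2 : ℝ) : ℂ)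
  else
    - ∑ s ∈ Finset.range (min (Nat.log 2 l) (Nat.log 2 l') + 1),
        if l / 2 ^ (Nat.log 2 l - s) = l' / 2 ^ (Nat.log 2 l' - s) then
          ip (Psi h (trunc l' (Nat.log 2 l' - s))) (Psi h (trunc l (Nat.log 2 l - s)))
        else 0

/-- The complete set of orthogonality conditions
`⟨ω ^ m 𝔥_{l'}(ω), ω ^ n 𝔥_l(ω)⟩ = δ_{m-n} β_{l,l'}` for `l, l', m, n ≥ 0`. -/
def CondH1 (B : ℝ) (h : ℕ → Hardy) : Prop :=
  ∀ l l' m n : ℕ, shiftIp m (h l') n (h l) = if m = n then beta B h l l' else 0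

/-- `{u, v}` is an orthonormal basis of `ℂ²`. -/
def IsONB (u v : C2) : Prop := ‖u‖ = 1 ∧ ‖v‖ = 1 ∧ ip u v = 0

/-- Families of type 1. -/
def IsType1 (B : ℝ) (h : ℕ → Hardy) : Prop :=
  ∃ (u₀ : C2) (B₀ : ℂ), ‖u₀‖ = 1 ∧ ‖B₀‖ ^ 2 = B ∧
    EqFun (h 0) (fun _ => B₀ • u₀) ∧
    ∀ l, 1 ≤ l → h l = 0

/-- Families of type 2. -/
def IsType2 (B : ℝ) (h : ℕ → Hardy) : Prop :=
  ∃ (u₀ u₁ : C2) (B₀ C₁ : ℂ), IsONB u₀ u₁ ∧ ‖B₀‖ ^ 2 = B ∧ ‖C₁‖ ^ 2 = B ∧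
    EqFun (h 0) (fun ω => ω • B₀ • u₀) ∧
    EqFun (h 1) (fun _ => C₁ • u₁) ∧
    ∀ l, 2 ≤ l → h l = 0

/-- Families of type 3. -/
def IsType3 (B : ℝ) (h : ℕ → Hardy) : Prop :=
  ∃ (u₀ u₁ : C2) (ρ θ : ℝ) (B₀ C₁ : ℂ), IsONB u₀ u₁ ∧ 0 < ρ ∧ ρ < 1 ∧
    ‖B₀‖ ^ 2 = B ∧ ‖C₁‖ ^ 2 = B * (1 - ρ ^ 2) ∧
    EqFun (h 0) (fun ω =>
      B₀ • ((ρ : ℂ) • u₀ + (ω * (√(1 - ρ ^ 2) : ℝ)) • u₁)) ∧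
    EqFun (h 1) (fun ω =>
      (C₁ * Complex.exp (θ * Complex.I)) •
        (((√(1 - ρ ^ 2) : ℝ) : ℂ) • u₀ - (ω * ρ) • u₁)) ∧
    (∀ p, 1 < p → EqFun (h (2 ^ p - 1)) (fun ω =>
      ((-(conj B₀ * ρ * (√(1 - ρ ^ 2) : ℝ) * Complex.exp (θ * Complex.I)) / conj C₁) ^ (p - 1)
          * C₁ * Complex.exp (θ * Complex.I)) •
        (((√(1 - ρ ^ 2) : ℝ) : ℂ) • u₀ - (ω * ρ) • u₁))) ∧
    ∀ l, 1 ≤ l → (∀ p, l ≠ 2 ^ p - 1) → h l = 0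

/-- Families of type 4. The sum over `k ≥ 1` is written with `k + 1`, `k ≥ 0`. -/
def IsType4 (B : ℝ) (h : ℕ → Hardy) : Prop :=
  ∃ (u₀ u₁ : C2) (ρ θ : ℝ) (B₀ C₁ : ℂ), IsONB u₀ u₁ ∧ 0 < ρ ∧ ρ < 1 ∧
    ‖B₀‖ ^ 2 = B ∧ ‖C₁‖ ^ 2 = B * (1 - ρ ^ 2) ∧
    EqFun (h 0) (fun ω =>
      (B₀ * (1 + (1 - (ρ : ℂ) ^ 2) / ρ * Complex.exp (θ * Complex.I) *
        ∑' k : ℕ, ω ^ (k + 1) * (-(ρ * Complex.exp (θ * Complex.I))) ^ k)) • (ρ : ℂ) • u₀) ∧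
    EqFun (h 1) (fun _ => C₁ • u₁) ∧
    (∀ p, 0 < p → EqFun (h (2 ^ p)) (fun _ =>
      ((B : ℂ) / conj C₁ * (-(ρ * Complex.exp (θ * Complex.I))) ^ p * (1 - (ρ : ℂ) ^ 2)) • u₁)) ∧
    ∀ l, 1 ≤ l → (∀ p, l ≠ 2 ^ p) → h l = 0

/-- The rule that gives `C_l` for `l = 2 ^ (e 0) + 2 ^ (e 1) + ⋯ + 2 ^ (e s)`,
`e 0 > e 1 > ⋯ > e s`, `s ≥ 1`, in terms of `C_1`, `C_{2 ^ k}` and `C_{2 ^ k + 1}`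
(it is trivially true when `l = 2 ^ k + 1`). -/
def ProductRule (C : ℕ → ℂ) : Prop :=
  ∀ (s : ℕ) (e : ℕ → ℕ), 1 ≤ s → (∀ i < s, e (i + 1) < e i) →
    C (∑ i ∈ Finset.range (s + 1), 2 ^ e i) =
      if e s = 0 then
        (C 1 ^ (s - 1))⁻¹ * ∏ i ∈ Finset.range s, C (2 ^ (e i - e (i + 1)) + 1)
      else
        (C 1 ^ s)⁻¹ * (∏ i ∈ Finset.range s, C (2 ^ (e i - e (i + 1)) + 1)) * C (2 ^ e s)

/-- Families of type 5. The sum over `k ≥ 1` is written with `k + 1`, `k ≥ 0`. The condition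
`⟨u₀, v⟩ ≠ 0` is the one under which the formula for `τ₁` makes sense. -/
def IsType5 (B : ℝ) (h : ℕ → Hardy) : Prop :=
  ∃ (u₀ u₁ v : C2) (ρ₀ ρ₁ τ₀ τ₁ r B₀ : ℂ) (C : ℕ → ℂ) (κ : ℝ),
    0 < ‖ρ₀‖ ∧ ‖ρ₀‖ < 1 ∧ κ = ‖ρ₀‖ ^ 2 / (1 - ‖ρ₀‖ ^ 2) ∧
    ‖u₀‖ = 1 ∧ ‖u₁‖ = 1 ∧ ‖v‖ = 1 ∧ ip u₀ v ≠ 0 ∧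
    (κ : ℂ) * ip u₀ u₁ * ip v u₀ + ip v u₁ = 0 ∧
    ‖ρ₁‖ ^ 2 = (1 - ‖ρ₀‖ ^ 2) / (1 + κ * ‖ip v u₀‖ ^ 2) ∧
    ‖τ₀‖ ^ 2 = 1 / (1 + κ * ‖ip u₁ u₀‖ ^ 2) ∧
    r = -(conj ρ₀ / conj ρ₁) * (ip v u₀ / ((1 + κ * ‖ip v u₀‖ ^ 2 : ℝ) : ℂ)) ∧
    τ₁ = τ₀ * (ρ₁ * ip u₁ v / (ρ₀ * ip u₀ v)) ∧
    ‖B₀‖ ^ 2 = B ∧ ‖C 1‖ ^ 2 = B * (1 - ‖ρ₀‖ ^ 2) ∧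
    (∀ p, 0 < p → C (2 ^ p) = (B : ℂ) / conj (C 1) * ((1 - ‖ρ₀‖ ^ 2 : ℝ) : ℂ) * r ^ p) ∧
    (∀ p, 0 < p → C (2 ^ p + 1) =
      C 1 * conj B₀ / conj (C 1) * (τ₁ / ρ₁) * ((1 - ‖ρ₀‖ ^ 2 : ℝ) : ℂ) * r ^ (p - 1)) ∧
    ProductRule C ∧
    EqFun (h 0) (fun ω =>
      B₀ • (ρ₀ • u₀ + (∑' k : ℕ, ω ^ (k + 1) * r ^ k) • ρ₁ • v)) ∧
    EqFun (h 1) (fun ω =>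
      C 1 • (τ₀ • u₁ + (∑' k : ℕ, ω ^ (k + 1) * r ^ k) • τ₁ • v)) ∧
    ∀ l, 1 ≤ l → h l = (C l / C 1) • h 1

end

noncomputable section

/-! For a fixed pair of indices, (h1) prescribes every Fourier coefficient of the pointwise scalar
product of `h l'` and `h l`; it says that this product is a.e. the constant β (`condH1_iff`). The
fibre ℂ² is two-dimensional, and each `h l` with l ≥ 1 is orthogonal to `h 0`, whose squared norm is
B > 0. If D = β_{1,1} ≠ 0, then `h l` = c_l `h 1`, so β_{l,l'} = D c_{l'} conj(c_l) has rank one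
(`CondH1.eq_smul`, `CondH1.beta_eq`).

On the other hand, β obeys a recursion on binary digits (`beta_of_two_le`): for l, l' ≥ 2, β_{l,l'}
+ ⟨Ψ_{l'}, Ψ_l⟩ is β at the numbers with second digit deleted if the two leading digits of l and l'
agree, and 0 otherwise. Put w_l = (Ψ_l, √D c_l) in ℂ³. Rank one and the recursion together make the
Gram matrix of the w_l, l ≥ 2, that of multiples of two orthogonal vectors: w_l = c_{l₁} w_2 or
c_{l₁} w_3, where l₁ = `dropSecond l`. Hence c_l is the product of r = c_2 over the digits 0 and g =
c_3 over the non-leading digits 1, and from index 1 on the Taylor coefficients of `h 0` and `h 1`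
are geometric with ratio r. All that remains is that w_1, w_2, w_3 are orthogonal with squared norms
B, D, D (`CondH1.exists_realization`). Conversely, three such rows always yield (h1)
(`condH1_of_realization`).

The types are coordinates for these rows. D = 0 is type 1, Ψ_1 = 0 is type 2, r = 0 with Ψ_1 ≠ 0 is
type 3, and r ≠ 0 is type 5. Type 4 is the parametrization of rows with g = 0 and r ≠ 0; it is
needed only for the converse. -/

/-! ### Fourier analysis on the circle and geometric series. -/

theorem ae_eq_zero_of_fourierCoeff_eq_zero {E : Type*} [NormedAddCommGroup E] [NormedSpace ℂ E]
    [CompleteSpace E] {f : UnitAddCircle → E} (hf : Integrable f haarAddCircle)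
    (h0 : ∀ n : ℤ, fourierCoeff f n = 0) : f =ᵐ[haarAddCircle] 0 := by
  have hint : ∀ g : C(UnitAddCircle, ℂ), Integrable (fun t => g t • f t) haarAddCircle := by
    intro g
    refine hf.bdd_smul ‖g‖ (map_continuous g).aestronglyMeasurable (ae_of_all _ fun t => ?_)
    exact g.norm_coe_le_norm t
  let L : C(UnitAddCircle, ℂ) →ₗ[ℂ] E :=
    { toFun := fun g => ∫ t, g t • f t ∂haarAddCircle
      map_add' := fun g g' => by
        simp only [ContinuousMap.add_apply, add_smul]
        exact integral_add (hint g) (hint g')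
      map_smul' := fun c g => by
        simp only [ContinuousMap.smul_apply, smul_assoc, RingHom.id_apply]
        exact integral_smul c _ }
  let Lc : C(UnitAddCircle, ℂ) →L[ℂ] E := L.mkContinuous (∫ t, ‖f t‖ ∂haarAddCircle) (by
    intro g
    calc ‖∫ t, g t • f t ∂haarAddCircle‖ ≤ ∫ t, ‖g t • f t‖ ∂haarAddCircle :=
          norm_integral_le_integral_norm _
      _ ≤ ∫ t, ‖f t‖ * ‖g‖ ∂haarAddCircle := by
          refine integral_mono (hint g).norm (hf.norm.mul_const _) fun t => ?_
          simp only [norm_smul]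
          rw [mul_comm]
          gcongr
          exact g.norm_coe_le_norm t
      _ = _ := integral_mul_const _ _)
  -- Integration against `f` is continuous in the sup norm and kills the characters, whose span is
  -- dense.
  have hker : ∀ g, Lc g = 0 := by
    have h1 : Submodule.span ℂ (Set.range (@fourier 1)) ≤ LinearMap.ker Lc.toLinearMap := by
      rw [Submodule.span_le]
      rintro _ ⟨n, rfl⟩
      have := h0 (-n)
      rw [fourierCoeff, neg_neg] at this
      exact this
    have h2 := Submodule.topologicalClosure_minimal _ h1 Lc.isClosed_ker
    rw [span_fourier_closure_eq_top] at h2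
    exact fun g => h2 trivial
  -- It suffices to test closed sets, and the indicator of a closed set is a pointwise limit of
  -- continuous functions with values in [0, 1].
  refine ae_eq_zero_of_forall_setIntegral_isClosed_eq_zero hf fun s hs => ?_
  have hlim : Filter.Tendsto
      (fun n => ∫ t, ((hs.apprSeq n t : ℝ) : ℂ) • f t ∂haarAddCircle) Filter.atTop
      (nhds (∫ t, s.indicator f t ∂haarAddCircle)) := by
    refine tendsto_integral_of_dominated_convergence (fun t => ‖f t‖) (fun n => ?_) hf.norm
      (fun n => ae_of_all _ fun t => ?_) (ae_of_all _ fun t => ?_)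
    · refine (Continuous.aestronglyMeasurable ?_).smul hf.1
      have := (hs.apprSeq n).continuous
      fun_prop
    · rw [norm_smul, Complex.norm_real, Real.norm_eq_abs, NNReal.abs_eq]
      have : ((hs.apprSeq n t : NNReal) : ℝ) ≤ 1 := by
        exact_mod_cast HasOuterApproxClosed.apprSeq_apply_le_one hs n t
      exact mul_le_of_le_one_left (norm_nonneg _) this
    · have h1 := (tendsto_pi_nhds.mp (HasOuterApproxClosed.tendsto_apprSeq hs)) t
      have h2 : Filter.Tendsto (fun n => ((hs.apprSeq n t : ℝ) : ℂ) • f t) Filter.atTop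
          (nhds ((((s.indicator (fun _ => (1 : NNReal)) t : NNReal) : ℝ) : ℂ) • f t)) := by
        refine Filter.Tendsto.smul_const ?_ _
        exact ((Complex.continuous_ofReal.comp NNReal.continuous_coe).tendsto _).comp h1
      convert h2 using 2
      by_cases ht : t ∈ s <;> simp [ht]
  have hz : ∀ n, ∫ t, ((hs.apprSeq n t : ℝ) : ℂ) • f t ∂haarAddCircle = 0 := by
    intro n
    exact hker ⟨fun t => ((hs.apprSeq n t : ℝ) : ℂ), by
      have := (hs.apprSeq n).continuous
      fun_prop⟩
  simp only [hz] at hlim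
  rw [← integral_indicator hs.measurableSet]
  exact tendsto_nhds_unique hlim tendsto_const_nhds

theorem norm_om (t : UnitAddCircle) : ‖om t‖ = 1 := Circle.norm_coe _

theorem continuous_om : Continuous om := by
  unfold om
  exact continuous_subtype_val.comp continuous_toCircle

theorem fourier_natCast (k : ℕ) (t : UnitAddCircle) : fourier (k : ℤ) t = om t ^ k := by
  rw [fourier_apply, om, natCast_zsmul, toCircle_nsmul]
  rfl

/-- The geometric series in closed form. -/
theorem tsum_shifted_geometric {r ω : ℂ} (hr : ‖r‖ < 1) (hω : ‖ω‖ = 1) :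
    ∑' k : ℕ, ω ^ (k + 1) * r ^ k = ω * (1 - ω * r)⁻¹ := by
  have h1 : ∀ k : ℕ, ω ^ (k + 1) * r ^ k = ω * (ω * r) ^ k := fun k => by ring
  simp only [h1]
  rw [tsum_mul_left, tsum_geometric_of_norm_lt_one]
  rw [norm_mul, hω, one_mul]
  exact hr

theorem one_sub_mul_ne_zero {r ω : ℂ} (hr : ‖r‖ < 1) (hω : ‖ω‖ = 1) : 1 - ω * r ≠ 0 := by
  intro h
  have h1 : ω * r = 1 := (sub_eq_zero.mp h).symm
  have : ‖ω * r‖ = 1 := by rw [h1, norm_one]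
  rw [norm_mul, hω, one_mul] at this
  exact hr.ne this

theorem continuous_geometric {r : ℂ} (hr : ‖r‖ < 1) :
    Continuous fun t => ∑' k : ℕ, om t ^ (k + 1) * r ^ k := by
  simp only [tsum_shifted_geometric hr (norm_om _)]
  exact continuous_om.mul (Continuous.inv₀ (by have := continuous_om; fun_prop)
    fun t => one_sub_mul_ne_zero hr (norm_om t))

theorem fourierCoeff_geometric {r : ℂ} (hr : ‖r‖ < 1) (n : ℤ) :
    HasSum (fun k : ℕ => r ^ k * (Pi.single ((k : ℤ) + 1) (1 : ℂ) : ℤ → ℂ) n)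
      (fourierCoeff (fun t : UnitAddCircle => ∑' k : ℕ, om t ^ (k + 1) * r ^ k) n) := by
  let F : ℕ → UnitAddCircle → ℂ := fun k t => fourier (-n) t * (om t ^ (k + 1) * r ^ k)
  have hc : ∀ k, Continuous (F k) := fun k => by
    have := continuous_om
    have := map_continuous (@fourier 1 (-n))
    fun_prop
  have hn : ∀ k t, ‖F k t‖ = ‖r‖ ^ k := fun k t => by
    simp only [F, norm_mul, norm_pow, norm_om, fourier_apply, Circle.norm_coe]
    simp
  have h1 := hasSum_integral_of_summable_integral_norm (μ := haarAddCircle) (F := F)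
    (fun k => (hc k).integrable_of_hasCompactSupport (HasCompactSupport.of_compactSpace _))
    (by
      simp only [hn, integral_const]
      simpa using summable_geometric_of_lt_one (norm_nonneg r) hr)
  have h2 : ∀ k, ∫ t, F k t ∂haarAddCircle
      = r ^ k * (Pi.single ((k : ℤ) + 1) (1 : ℂ) : ℤ → ℂ) n := by
    intro k
    rw [← fourierCoeff_fourier (T := 1), ← fourierCoeff.const_mul]
    unfold fourierCoeff
    congr 1
    ext t
    have : fourier ((k : ℤ) + 1) t = om t ^ (k + 1) := by
      rw [← fourier_natCast]; push_cast; rfl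
    simp only [F, this, smul_eq_mul]
    ring
  simp only [h2] at h1
  have h3 : fourierCoeff (fun t : UnitAddCircle => ∑' k : ℕ, om t ^ (k + 1) * r ^ k) n
      = ∫ t, ∑' k, F k t ∂haarAddCircle := by
    simp only [F, tsum_mul_left]
    rfl
  rwa [h3]

theorem fourierCoeff_geometric_succ {r : ℂ} (hr : ‖r‖ < 1) (j : ℕ) :
    fourierCoeff (fun t : UnitAddCircle => ∑' k : ℕ, om t ^ (k + 1) * r ^ k) ((j + 1 : ℕ) : ℤ)
      = r ^ j := by
  refine (fourierCoeff_geometric hr _).unique ?_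
  convert hasSum_ite_eq j (r ^ j) using 2 with k
  by_cases h : k = j
  · subst h; simp
  · have : ((j + 1 : ℕ) : ℤ) ≠ (k : ℤ) + 1 := by omega
    simp [h]

theorem fourierCoeff_geometric_nonpos {r : ℂ} (hr : ‖r‖ < 1) {n : ℤ} (hn : n ≤ 0) :
    fourierCoeff (fun t : UnitAddCircle => ∑' k : ℕ, om t ^ (k + 1) * r ^ k) n = 0 := by
  refine (fourierCoeff_geometric hr _).unique ?_
  convert hasSum_zero using 2 with k
  have : n ≠ (k : ℤ) + 1 := by omega
  simp [this]

theorem fourierCoeff_const {E : Type*} [NormedAddCommGroup E] [NormedSpace ℂ E]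
    [CompleteSpace E] (x : E) (n : ℤ) :
    fourierCoeff (fun _ : UnitAddCircle => x) n = if n = 0 then x else 0 := by
  have h1 := congrFun (fourierCoeff_fourier (T := 1) 0) n
  unfold fourierCoeff at h1 ⊢
  rw [integral_smul_const]
  simp only [fourier_zero, smul_eq_mul, mul_one] at h1
  rw [h1]
  by_cases h : n = 0 <;> simp [h]

theorem fourierCoeff_smul_const {E : Type*} [NormedAddCommGroup E] [NormedSpace ℂ E]
    [CompleteSpace E] (φ : UnitAddCircle → ℂ) (x : E) (n : ℤ) :
    fourierCoeff (fun t => φ t • x) n = fourierCoeff φ n • x := by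
  unfold fourierCoeff
  rw [← integral_smul_const]
  simp only [smul_assoc]

theorem integrable_bd (f : Hardy) : Integrable (bd f) haarAddCircle :=
  (Lp.memLp (f : L2Circle)).integrable (by norm_num)

/-- The bridge between explicit formulas and the vectors Ψ: all five types have boundary functions
of this shape, possibly with r = 0 or y = 0. Negative Fourier coefficients need no check, since `f`
lies in the Hardy space. -/
theorem eqFun_geometric_iff (f : Hardy) (x y : C2) {r : ℂ} (hr : ‖r‖ < 1) :
    EqFun f (fun ω => x + (∑' k : ℕ, ω ^ (k + 1) * r ^ k) • y) ↔
      taylor f 0 = x ∧ ∀ k, taylor f (k + 1) = r ^ k • y := by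
  set S : UnitAddCircle → ℂ := fun t => ∑' k : ℕ, om t ^ (k + 1) * r ^ k with hS
  have hSc : Continuous S := continuous_geometric hr
  have hG2 : Integrable (fun t => S t • y) haarAddCircle :=
    (hSc.smul continuous_const).integrable_of_hasCompactSupport
      (HasCompactSupport.of_compactSpace _)
  have hG1 : Integrable (fun _ : UnitAddCircle => x) haarAddCircle := integrable_const x
  have hG : ∀ n, fourierCoeff (fun t => x + S t • y) n
      = (if n = 0 then x else 0) + fourierCoeff S n • y := by
    intro n
    rw [show (fun t => x + S t • y) = (fun _ => x) + fun t => S t • y from rfl,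
      fourierCoeff.add hG1 hG2, Pi.add_apply, fourierCoeff_const, fourierCoeff_smul_const]
  constructor
  · intro h
    have h1 : fourierCoeff (bd f) = fourierCoeff (fun t => x + S t • y) := fourierCoeff_congr_ae h
    refine ⟨?_, fun k => ?_⟩
    · rw [taylor, h1, hG, hS, fourierCoeff_geometric_nonpos hr (by simp)]; simp
    · rw [taylor, h1, hG, hS, fourierCoeff_geometric_succ hr, if_neg (by omega), zero_add]
  · rintro ⟨h0, h1⟩
    have hz : (bd f - fun t => x + S t • y) =ᵐ[haarAddCircle] 0 := by
      refine ae_eq_zero_of_fourierCoeff_eq_zero ((integrable_bd f).sub (hG1.add hG2)) fun n => ?_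
      have hsub : fourierCoeff (bd f - fun t => x + S t • y) n
          = fourierCoeff (bd f) n - fourierCoeff (fun t => x + S t • y) n := by
        rw [sub_eq_add_neg, show (-fun t => x + S t • y) = (-1 : ℂ) • (fun t => x + S t • y) by
            simp, fourierCoeff.add (g := (-1 : ℂ) • fun t => x + S t • y) (integrable_bd f)
            ((hG1.add hG2).smul (-1 : ℂ)), Pi.add_apply,
          fourierCoeff.const_smul]
        simp [sub_eq_add_neg]
      rw [hsub, hG, sub_eq_zero]
      rcases lt_trichotomy n 0 with hn | hn | hn
      · rw [hS, fourierCoeff_geometric_nonpos hr hn.le, if_neg hn.ne]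
        rw [zero_smul, add_zero]
        exact f.2 n hn
      · subst hn
        rw [hS, fourierCoeff_geometric_nonpos hr le_rfl]
        simpa [taylor] using h0
      · obtain ⟨k, rfl⟩ : ∃ k : ℕ, n = ((k + 1 : ℕ) : ℤ) := ⟨(n - 1).toNat, by omega⟩
        rw [hS, fourierCoeff_geometric_succ hr, if_neg hn.ne', zero_add]
        exact h1 k
    filter_upwards [hz] with t ht
    exact sub_eq_zero.mp ht

/-! ### The scalar product and the pointwise form of (h1). -/

theorem ip_smul_left (c : ℂ) (x y : C2) : ip (c • x) y = c * ip x y := inner_smul_right _ _ _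

theorem ip_smul_right (c : ℂ) (x y : C2) : ip x (c • y) = conj c * ip x y := inner_smul_left _ _ _

theorem ip_add_left (x y z : C2) : ip (x + y) z = ip x z + ip y z := inner_add_right _ _ _

theorem ip_add_right (x y z : C2) : ip x (y + z) = ip x y + ip x z := inner_add_left _ _ _

theorem ip_conj (x y : C2) : conj (ip x y) = ip y x := inner_conj_symm _ _

theorem ip_self (x : C2) : ip x x = ((‖x‖ ^ 2 : ℝ) : ℂ) := by
  rw [ip, inner_self_eq_norm_sq_to_K]; norm_cast

theorem ip_zero_left (x : C2) : ip 0 x = 0 := inner_zero_right _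

theorem ip_zero_right (x : C2) : ip x 0 = 0 := inner_zero_left _

theorem integrable_ip_bd (f g : Hardy) :
    Integrable (fun t => ip (bd f t) (bd g t)) haarAddCircle :=
  L2.integrable_inner (𝕜 := ℂ) (g : L2Circle) (f : L2Circle)

theorem shiftIp_eq_fourierCoeff (f g : Hardy) (m n : ℕ) :
    shiftIp m f n g = fourierCoeff (fun t => ip (bd f t) (bd g t)) ((n : ℤ) - m) := by
  unfold shiftIp fourierCoeff
  congr 1
  ext t
  rw [ip_smul_left, ip_smul_right, ← fourier_natCast, ← fourier_natCast, ← fourier_neg,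
    ← mul_assoc, ← fourier_add, smul_eq_mul]
  congr 2
  ring_nf

/-- Orthogonality of all shifts means that the pointwise scalar product is constant. -/
theorem shiftIp_eq_ite_iff (f g : Hardy) (β : ℂ) :
    (∀ m n : ℕ, shiftIp m f n g = if m = n then β else 0) ↔
      ∀ᵐ t ∂(haarAddCircle : Measure UnitAddCircle), ip (bd f t) (bd g t) = β := by
  constructor
  · intro h
    have hz : ((fun t => ip (bd f t) (bd g t)) + fun _ => -β) =ᵐ[haarAddCircle] 0 := by
      refine ae_eq_zero_of_fourierCoeff_eq_zero
        ((integrable_ip_bd f g).add (integrable_const _)) fun N => ?_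
      rw [fourierCoeff.add (integrable_ip_bd f g) (integrable_const _), Pi.add_apply,
        fourierCoeff_const]
      -- Only differences of shifts matter, and every integer is a difference of naturals, so (h1)
      -- reaches every Fourier coefficient.
      obtain ⟨m, n, rfl⟩ : ∃ m n : ℕ, N = (n : ℤ) - m := ⟨(-N).toNat, N.toNat, by omega⟩
      rw [← shiftIp_eq_fourierCoeff, h]
      by_cases hmn : m = n
      · simp [hmn]
      · rw [if_neg hmn, if_neg (by omega), add_zero]
    filter_upwards [hz] with t ht
    simpa [add_neg_eq_zero] using ht
  · intro h m n
    have h' : (fun t => ip (bd f t) (bd g t)) =ᵐ[haarAddCircle] fun _ => β := h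
    rw [shiftIp_eq_fourierCoeff, fourierCoeff_congr_ae h', fourierCoeff_const]
    by_cases hmn : m = n
    · simp [hmn]
    · rw [if_neg hmn, if_neg (by omega)]

theorem condH1_iff (B : ℝ) (h : ℕ → Hardy) :
    CondH1 B h ↔ ∀ l l' : ℕ, ∀ᵐ t ∂(haarAddCircle : Measure UnitAddCircle),
      ip (bd (h l') t) (bd (h l) t) = beta B h l l' := by
  refine forall_congr' fun l => forall_congr' fun l' => ?_
  exact shiftIp_eq_ite_iff _ _ _

theorem bd_smul (c : ℂ) (f : Hardy) : bd (c • f) =ᵐ[haarAddCircle] fun t => c • bd f t :=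
  Lp.coeFn_smul c (f : L2Circle)

theorem bd_zero : bd 0 =ᵐ[haarAddCircle] fun _ => (0 : C2) := Lp.coeFn_zero _ _ _

theorem Hardy.ext_bd {f g : Hardy} (h : bd f =ᵐ[haarAddCircle] bd g) : f = g :=
  Subtype.ext (Lp.ext h)

theorem taylor_smul (c : ℂ) (f : Hardy) (k : ℕ) : taylor (c • f) k = c • taylor f k := by
  rw [taylor, fourierCoeff_congr_ae (bd_smul c f)]
  exact fourierCoeff.const_smul (bd f) c k

theorem EqFun.smul {f : Hardy} {F : ℂ → C2} (h : EqFun f F) (c : ℂ) :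
    EqFun (c • f) fun ω => c • F ω := by
  filter_upwards [h, bd_smul c f] with t h1 h2
  rw [h2, h1]

theorem EqFun.congr {f : Hardy} {F G : ℂ → C2} (h : EqFun f F) (hFG : ∀ ω, ‖ω‖ = 1 → F ω = G ω) :
    EqFun f G := by
  filter_upwards [h] with t h1
  rw [h1, hFG _ (norm_om t)]

theorem EqFun.unique {f g : Hardy} {F : ℂ → C2} (hf : EqFun f F) (hg : EqFun g F) : f = g := by
  refine Hardy.ext_bd ?_
  filter_upwards [hf, hg] with t h1 h2
  rw [h1, h2]

/-! ### Binary digits: deleting the second digit. -/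

/-- The number obtained from `l ≥ 2` by deleting its second leading binary digit. -/
def dropSecond (l : ℕ) : ℕ := trunc l (Nat.log 2 l - 1)

/-- The number formed by the two leading binary digits of `l ≥ 2`. -/
def leadingPair (l : ℕ) : ℕ := l / 2 ^ (Nat.log 2 l - 1)

theorem log_trunc (l j : ℕ) : Nat.log 2 (trunc l j) = j := by
  have := Nat.mod_lt l (Nat.two_pow_pos j)
  refine Nat.log_eq_of_pow_le_of_lt_pow (by unfold trunc; omega) ?_
  rw [pow_succ, trunc]
  omega

theorem trunc_log {l : ℕ} (hl : 1 ≤ l) : trunc l (Nat.log 2 l) = l := by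
  have h1 : 2 ^ Nat.log 2 l ≤ l := Nat.pow_log_le_self 2 (by omega)
  have h2 : l < 2 ^ (Nat.log 2 l + 1) := Nat.lt_pow_succ_log_self (by norm_num) l
  rw [pow_succ] at h2
  rw [trunc, Nat.mod_eq_sub_mod h1, Nat.mod_eq_of_lt (by omega)]
  omega

theorem trunc_zero (l : ℕ) : trunc l 0 = 1 := by simp [trunc, Nat.mod_one]

theorem trunc_trunc (l : ℕ) {i j : ℕ} (h : i ≤ j) : trunc (trunc l j) i = trunc l i := by
  unfold trunc
  have h1 : 2 ^ i ∣ 2 ^ j := pow_dvd_pow 2 h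
  rw [Nat.add_mod, Nat.mod_mod_of_dvd _ h1, Nat.mod_eq_zero_of_dvd h1, zero_add, Nat.mod_mod]

theorem log_pos_of_two_le {l : ℕ} (hl : 2 ≤ l) : 1 ≤ Nat.log 2 l :=
  Nat.log_pos (by norm_num) hl

theorem log_dropSecond (l : ℕ) : Nat.log 2 (dropSecond l) = Nat.log 2 l - 1 := log_trunc _ _

theorem one_le_trunc (l j : ℕ) : 1 ≤ trunc l j :=
  le_trans (Nat.one_le_two_pow) (Nat.le_add_right _ _)

theorem one_le_dropSecond (l : ℕ) : 1 ≤ dropSecond l := one_le_trunc _ _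

theorem leadingPair_mul_add (l : ℕ) :
    leadingPair l * 2 ^ (Nat.log 2 l - 1) + l % 2 ^ (Nat.log 2 l - 1) = l := by
  rw [leadingPair, mul_comm]
  exact Nat.div_add_mod _ _

theorem leadingPair_eq {l : ℕ} (hl : 2 ≤ l) : leadingPair l = 2 ∨ leadingPair l = 3 := by
  have hp := log_pos_of_two_le hl
  have h1 : 2 ^ Nat.log 2 l ≤ l := Nat.pow_log_le_self 2 (by omega)
  have h2 : l < 2 ^ (Nat.log 2 l + 1) := Nat.lt_pow_succ_log_self (by norm_num) l
  obtain ⟨q, hq⟩ : ∃ q, Nat.log 2 l = q + 1 := ⟨_, (Nat.sub_add_cancel hp).symm⟩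
  rw [hq] at h1 h2
  have h3 : leadingPair l = l / 2 ^ q := by rw [leadingPair, hq]; rfl
  have h4 : 2 ≤ l / 2 ^ q := by
    rw [Nat.le_div_iff_mul_le (Nat.two_pow_pos q)]; rw [pow_succ] at h1; omega
  have h5 : l / 2 ^ q < 4 := by
    rw [Nat.div_lt_iff_lt_mul (Nat.two_pow_pos q)]; rw [pow_succ, pow_succ] at h2; omega
  omega

theorem dropSecond_lt {l : ℕ} (hl : 2 ≤ l) : dropSecond l < l := by
  have h1 := leadingPair_mul_add l
  have h2 := Nat.two_pow_pos (Nat.log 2 l - 1)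
  rw [dropSecond, trunc]
  rcases leadingPair_eq hl with h | h <;> rw [h] at h1 <;> omega

theorem eq_of_dropSecond_eq {l l' : ℕ} (hl : 2 ≤ l) (hl' : 2 ≤ l')
    (hp : leadingPair l = leadingPair l') (hd : dropSecond l = dropSecond l') : l = l' := by
  have h1 := log_dropSecond l
  have h2 := log_dropSecond l'
  have h3 := log_pos_of_two_le hl
  have h4 := log_pos_of_two_le hl'
  rw [hd] at h1
  have h5 : Nat.log 2 l = Nat.log 2 l' := by omega
  have h6 : l % 2 ^ (Nat.log 2 l - 1) = l' % 2 ^ (Nat.log 2 l - 1) := by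
    unfold dropSecond trunc at hd
    rw [← h5] at hd
    omega
  rw [← leadingPair_mul_add l, ← leadingPair_mul_add l', hp, ← h5, h6]

theorem div_two_pow_of_le {l s : ℕ} (hs : s + 1 ≤ Nat.log 2 l) :
    l / 2 ^ (Nat.log 2 l - (s + 1)) =
      leadingPair l * 2 ^ s + l % 2 ^ (Nat.log 2 l - 1) / 2 ^ (Nat.log 2 l - (s + 1)) := by
  have h1 : 2 ^ (Nat.log 2 l - 1) = 2 ^ s * 2 ^ (Nat.log 2 l - (s + 1)) := by
    rw [← pow_add]; congr 1; omega
  have h2 := Nat.two_pow_pos (Nat.log 2 l - (s + 1))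
  conv_lhs => enter [1]; rw [← leadingPair_mul_add l]
  rw [h1, ← mul_assoc, add_comm, Nat.add_mul_div_right _ _ h2, add_comm]

theorem dropSecond_div_two_pow {l s : ℕ} (hs : s + 1 ≤ Nat.log 2 l) :
    dropSecond l / 2 ^ (Nat.log 2 (dropSecond l) - s) =
      2 ^ s + l % 2 ^ (Nat.log 2 l - 1) / 2 ^ (Nat.log 2 l - (s + 1)) := by
  have h1 : 2 ^ (Nat.log 2 l - 1) = 2 ^ s * 2 ^ (Nat.log 2 l - (s + 1)) := by
    rw [← pow_add]; congr 1; omega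
  have h2 := Nat.two_pow_pos (Nat.log 2 l - (s + 1))
  rw [log_dropSecond, show Nat.log 2 l - 1 - s = Nat.log 2 l - (s + 1) by omega, dropSecond, trunc]
  conv_lhs => enter [1, 1]; rw [h1]
  rw [add_comm, Nat.add_mul_div_right _ _ h2, add_comm]

theorem mod_div_two_pow_lt {l s : ℕ} (hs : s + 1 ≤ Nat.log 2 l) :
    l % 2 ^ (Nat.log 2 l - 1) / 2 ^ (Nat.log 2 l - (s + 1)) < 2 ^ s := by
  have h1 : 2 ^ (Nat.log 2 l - 1) = 2 ^ s * 2 ^ (Nat.log 2 l - (s + 1)) := by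
    rw [← pow_add]; congr 1; omega
  rw [Nat.div_lt_iff_lt_mul (Nat.two_pow_pos _), ← h1]
  exact Nat.mod_lt _ (Nat.two_pow_pos _)

/-- Deleting the second digit leaves the later digits of a prefix unchanged: a prefix of s + 2
digits is the leading pair followed by s digits, and after deletion it is 1 followed by the same s
digits. The bound by 2 ^ s separates the two blocks. -/
theorem prefix_eq_iff {l l' s : ℕ} (hs : s + 1 ≤ Nat.log 2 l) (hs' : s + 1 ≤ Nat.log 2 l') :
    l / 2 ^ (Nat.log 2 l - (s + 1)) = l' / 2 ^ (Nat.log 2 l' - (s + 1)) ↔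
      leadingPair l = leadingPair l' ∧
        dropSecond l / 2 ^ (Nat.log 2 (dropSecond l) - s) =
          dropSecond l' / 2 ^ (Nat.log 2 (dropSecond l') - s) := by
  rw [div_two_pow_of_le hs, div_two_pow_of_le hs', dropSecond_div_two_pow hs,
    dropSecond_div_two_pow hs']
  have h1 := mod_div_two_pow_lt hs
  have h2 := mod_div_two_pow_lt hs'
  generalize l % 2 ^ (Nat.log 2 l - 1) / 2 ^ (Nat.log 2 l - (s + 1)) = x at *
  generalize l' % 2 ^ (Nat.log 2 l' - 1) / 2 ^ (Nat.log 2 l' - (s + 1)) = y at *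
  constructor
  · intro h
    have h3 : leadingPair l = leadingPair l' := by
      have h4 : (leadingPair l * 2 ^ s + x) / 2 ^ s = leadingPair l := by
        rw [add_comm, Nat.add_mul_div_right _ _ (Nat.two_pow_pos s), Nat.div_eq_of_lt h1, zero_add]
      have h5 : (leadingPair l' * 2 ^ s + y) / 2 ^ s = leadingPair l' := by
        rw [add_comm, Nat.add_mul_div_right _ _ (Nat.two_pow_pos s), Nat.div_eq_of_lt h2, zero_add]
      rw [← h4, ← h5, h]
    rw [h3] at h
    exact ⟨h3, by omega⟩
  · rintro ⟨h3, h4⟩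
    rw [h3]
    omega

/-! ### Values of β and its recursion. -/

theorem beta_zero_zero (B : ℝ) (h : ℕ → Hardy) : beta B h 0 0 = B := by simp [beta]

theorem beta_zero_left (B : ℝ) (h : ℕ → Hardy) {l : ℕ} (hl : 1 ≤ l) : beta B h 0 l = 0 := by
  have : l ≠ 0 := by omega
  simp [beta, this]

theorem beta_zero_right (B : ℝ) (h : ℕ → Hardy) {l : ℕ} (hl : 1 ≤ l) : beta B h l 0 = 0 := by
  have : l ≠ 0 := by omega
  simp [beta, this]

theorem beta_one_one (B : ℝ) (h : ℕ → Hardy) :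
    beta B h 1 1 = ((B - ‖Psi h 1‖ ^ 2 : ℝ) : ℂ) := by
  simp [beta, trunc_zero]

theorem beta_one_right (B : ℝ) (h : ℕ → Hardy) {l : ℕ} (hl : 2 ≤ l) :
    beta B h l 1 = -ip (Psi h 1) (Psi h l) := by
  have h1 : l ≠ 0 := by omega
  have h2 : l ≠ 1 := by omega
  have h3 : l / 2 ^ Nat.log 2 l = 1 := by
    have h1 : 2 ^ Nat.log 2 l ≤ l := Nat.pow_log_le_self 2 (by omega)
    have h2 : l < 2 ^ (Nat.log 2 l + 1) := Nat.lt_pow_succ_log_self (by norm_num) l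
    rw [pow_succ] at h2
    exact Nat.div_eq_of_lt_le (by omega) (by omega)
  simp [beta, h1, h2, trunc_zero, trunc_log (show 1 ≤ l by omega), h3]

theorem beta_conj (B : ℝ) (h : ℕ → Hardy) (l l' : ℕ) : conj (beta B h l l') = beta B h l' l := by
  unfold beta
  by_cases h0 : l = 0 ∧ l' = 0
  · rw [if_pos h0, if_pos h0.symm, Complex.conj_ofReal]
  by_cases h1 : l = 0 ∨ l' = 0
  · rw [if_neg h0, if_pos h1, if_neg (fun h => h0 h.symm), if_pos h1.symm, map_zero]
  by_cases h2 : l = l'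
  · subst h2
    rw [if_neg h0, if_neg h1, if_pos rfl, Complex.conj_ofReal]
  rw [if_neg h0, if_neg h1, if_neg h2, if_neg (fun h => h0 h.symm), if_neg (fun h => h1 h.symm),
    if_neg (Ne.symm h2), map_neg, map_sum, min_comm]
  congr 1
  refine Finset.sum_congr rfl fun s _ => ?_
  rw [apply_ite conj, map_zero, ip_conj]
  exact if_congr eq_comm rfl rfl

/-- The term s = 0 compares only the leading digits 1, so it is always present and gives the scalar
product. By `prefix_eq_iff` the terms s + 1 are the terms s for the shortened numbers when the
leading pairs agree, and vanish otherwise. -/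
theorem beta_of_two_le (B : ℝ) (h : ℕ → Hardy) {l l' : ℕ} (hl : 2 ≤ l) (hl' : 2 ≤ l') :
    beta B h l l' = -ip (Psi h l') (Psi h l) +
      if leadingPair l = leadingPair l' then beta B h (dropSecond l) (dropSecond l') else 0 := by
  have hd := one_le_dropSecond l
  have hd' := one_le_dropSecond l'
  have hp := log_pos_of_two_le hl
  have hp' := log_pos_of_two_le hl'
  have e1 : ∀ {a b : ℕ}, 1 ≤ a → 1 ≤ b → ¬ (a = 0 ∧ b = 0) := fun _ _ => by omega
  have e2 : ∀ {a b : ℕ}, 1 ≤ a → 1 ≤ b → ¬ (a = 0 ∨ b = 0) := fun _ _ => by omega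
  unfold beta
  rw [if_neg (e1 (by omega) (by omega)), if_neg (e2 (by omega) (by omega)), if_neg (e1 hd hd'),
    if_neg (e2 hd hd')]
  by_cases hll : l = l'
  · subst hll
    rw [if_pos rfl, if_pos rfl, if_pos rfl, Finset.sum_range_succ, trunc_log (by omega),
      log_dropSecond, Nat.sub_add_cancel hp, ip_self]
    have : ∑ j ∈ Finset.range (Nat.log 2 l), ‖Psi h (trunc (dropSecond l) j)‖ ^ 2
        = ∑ j ∈ Finset.range (Nat.log 2 l), ‖Psi h (trunc l j)‖ ^ 2 :=
      Finset.sum_congr rfl fun j hj => by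
        rw [dropSecond, trunc_trunc]
        have := Finset.mem_range.mp hj
        omega
    rw [this]
    push_cast
    ring
  rw [if_neg hll, Finset.sum_range_succ', if_pos]
  swap
  · have aux : ∀ {l : ℕ}, 2 ≤ l → l / 2 ^ (Nat.log 2 l - 0) = 1 := by
      intro l hl
      have h1 : 2 ^ Nat.log 2 l ≤ l := Nat.pow_log_le_self 2 (by omega)
      have h2 : l < 2 ^ (Nat.log 2 l + 1) := Nat.lt_pow_succ_log_self (by norm_num) l
      rw [pow_succ] at h2
      exact Nat.div_eq_of_lt_le (by simpa using h1) (by rw [Nat.sub_zero]; omega)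
    rw [aux hl, aux hl']
  rw [Nat.sub_zero, Nat.sub_zero, trunc_log (show 1 ≤ l by omega), trunc_log (show 1 ≤ l' by omega),
    neg_add, add_comm]
  congr 1
  by_cases hlp : leadingPair l = leadingPair l'
  -- β has a separate formula on the diagonal; with equal leading pairs, an off-diagonal pair never
  -- shortens to a diagonal one.
  · have hne : dropSecond l ≠ dropSecond l' := fun hc => hll (eq_of_dropSecond_eq hl hl' hlp hc)
    rw [if_pos hlp, if_neg hne]
    have hr : min (Nat.log 2 l) (Nat.log 2 l')
        = min (Nat.log 2 (dropSecond l)) (Nat.log 2 (dropSecond l')) + 1 := by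
      rw [log_dropSecond, log_dropSecond]; omega
    rw [hr]
    congr 1
    refine Finset.sum_congr rfl fun s hs => ?_
    rw [Finset.mem_range, log_dropSecond, log_dropSecond] at hs
    have hs1 : s + 1 ≤ Nat.log 2 l := by omega
    have hs2 : s + 1 ≤ Nat.log 2 l' := by omega
    refine if_congr ?_ ?_ rfl
    · rw [prefix_eq_iff hs1 hs2]
      exact and_iff_right hlp
    · have t : ∀ l, s + 1 ≤ Nat.log 2 l →
          trunc (dropSecond l) (Nat.log 2 (dropSecond l) - s)
            = trunc l (Nat.log 2 l - (s + 1)) := by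
        intro l hl
        rw [log_dropSecond, dropSecond, trunc_trunc _ (by omega)]
        congr 1
        omega
      rw [t l hs1, t l' hs2]
  · rw [if_neg hlp, neg_eq_zero]
    refine Finset.sum_eq_zero fun s hs => ?_
    rw [Finset.mem_range] at hs
    rw [if_neg]
    rw [prefix_eq_iff (by omega) (by omega)]
    exact fun hc => hlp hc.1

/-! ### The indices of Ψ and their shortened forms. -/

/-- Every `l ≥ 2` is a power of two or `2 ^ (log m + k + 1) + m` with `m ≥ 1`. -/
theorem eq_two_pow_or_eq_add {l : ℕ} (hl : 2 ≤ l) :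
    (∃ p, l = 2 ^ (p + 1)) ∨ ∃ m k, 1 ≤ m ∧ l = 2 ^ (Nat.log 2 m + k + 1) + m := by
  have h1 : 2 ^ Nat.log 2 l ≤ l := Nat.pow_log_le_self 2 (by omega)
  have h2 : l < 2 ^ (Nat.log 2 l + 1) := Nat.lt_pow_succ_log_self (by norm_num) l
  have hp := log_pos_of_two_le hl
  rcases h1.eq_or_lt with h | h
  · exact Or.inl ⟨Nat.log 2 l - 1, by rw [Nat.sub_add_cancel hp]; exact h.symm⟩
  · refine Or.inr ⟨l - 2 ^ Nat.log 2 l, Nat.log 2 l - Nat.log 2 (l - 2 ^ Nat.log 2 l) - 1,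
      by omega, ?_⟩
    have h3 : Nat.log 2 (l - 2 ^ Nat.log 2 l) < Nat.log 2 l := by
      refine Nat.log_lt_of_lt_pow (by omega) ?_
      rw [pow_succ] at h2
      omega
    rw [show Nat.log 2 (l - 2 ^ Nat.log 2 l)
      + (Nat.log 2 l - Nat.log 2 (l - 2 ^ Nat.log 2 l) - 1) + 1 = Nat.log 2 l by omega]
    omega

theorem log_two_pow_add {m : ℕ} (k : ℕ) :
    Nat.log 2 (2 ^ (Nat.log 2 m + k + 1) + m) = Nat.log 2 m + k + 1 := by
  have h2 : m < 2 ^ (Nat.log 2 m + 1) := Nat.lt_pow_succ_log_self (by norm_num) m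
  have h3 : 2 ^ (Nat.log 2 m + 1) ≤ 2 ^ (Nat.log 2 m + k + 1) :=
    Nat.pow_le_pow_right (by norm_num) (by omega)
  refine Nat.log_eq_of_pow_le_of_lt_pow (by omega) ?_
  rw [pow_succ _ (Nat.log 2 m + k + 1)]
  omega

theorem dropSecond_two_pow (p : ℕ) : dropSecond (2 ^ (p + 1)) = 2 ^ p := by
  rw [dropSecond, Nat.log_pow (by norm_num), trunc, Nat.add_sub_cancel, pow_succ]
  simp

theorem leadingPair_two_pow (p : ℕ) : leadingPair (2 ^ (p + 1)) = 2 := by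
  rw [leadingPair, Nat.log_pow (by norm_num), Nat.add_sub_cancel, pow_succ]
  simp

theorem dropSecond_two_pow_add_succ (m k : ℕ) :
    dropSecond (2 ^ (Nat.log 2 m + (k + 1) + 1) + m) = 2 ^ (Nat.log 2 m + k + 1) + m := by
  have h2 : m < 2 ^ (Nat.log 2 m + 1) := Nat.lt_pow_succ_log_self (by norm_num) m
  have h3 : 2 ^ (Nat.log 2 m + 1) ≤ 2 ^ (Nat.log 2 m + k + 1) :=
    Nat.pow_le_pow_right (by norm_num) (by omega)
  rw [dropSecond, log_two_pow_add, trunc, Nat.add_sub_cancel, ← add_assoc,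
    pow_succ _ (Nat.log 2 m + k + 1), Nat.mul_add_mod, Nat.mod_eq_of_lt (by omega)]

theorem leadingPair_two_pow_add_succ (m k : ℕ) :
    leadingPair (2 ^ (Nat.log 2 m + (k + 1) + 1) + m) = 2 := by
  have h2 : m < 2 ^ (Nat.log 2 m + 1) := Nat.lt_pow_succ_log_self (by norm_num) m
  have h3 : 2 ^ (Nat.log 2 m + 1) ≤ 2 ^ (Nat.log 2 m + k + 1) :=
    Nat.pow_le_pow_right (by norm_num) (by omega)
  rw [leadingPair, log_two_pow_add, Nat.add_sub_cancel, ← add_assoc,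
    pow_succ _ (Nat.log 2 m + k + 1), Nat.mul_add_div (Nat.two_pow_pos _),
    Nat.div_eq_of_lt (by omega)]

theorem mod_two_pow_log {m : ℕ} (hm : 1 ≤ m) : 2 ^ Nat.log 2 m + m % 2 ^ Nat.log 2 m = m :=
  trunc_log hm

theorem dropSecond_two_pow_add_zero {m : ℕ} (hm : 1 ≤ m) :
    dropSecond (2 ^ (Nat.log 2 m + 0 + 1) + m) = m := by
  rw [dropSecond, log_two_pow_add 0, trunc, Nat.add_sub_cancel, add_zero, pow_succ,
    Nat.mul_add_mod, mod_two_pow_log hm]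

theorem leadingPair_two_pow_add_zero {m : ℕ} (hm : 1 ≤ m) :
    leadingPair (2 ^ (Nat.log 2 m + 0 + 1) + m) = 3 := by
  have h1 : 2 ^ Nat.log 2 m ≤ m := Nat.pow_log_le_self 2 (by omega)
  have h2 : m < 2 ^ (Nat.log 2 m + 1) := Nat.lt_pow_succ_log_self (by norm_num) m
  rw [pow_succ] at h2
  rw [leadingPair, log_two_pow_add 0, Nat.add_sub_cancel, add_zero, pow_succ,
    Nat.mul_add_div (Nat.two_pow_pos _), Nat.div_eq_of_lt_le (k := 1) (by omega) (by omega)]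

/-! ### The multiplicative weight of a binary expansion. -/

/-- The product of `r` for every digit `0` and `g` for every non-leading digit `1` of `l`. -/
def digitWeight (r g : ℂ) (l : ℕ) : ℂ :=
  if _h : l ≤ 1 then 1 else (if l % 2 = 0 then r else g) * digitWeight r g (l / 2)
termination_by l
decreasing_by omega

theorem digitWeight_one (r g : ℂ) : digitWeight r g 1 = 1 := by
  rw [digitWeight]; simp

theorem digitWeight_of_two_le (r g : ℂ) {l : ℕ} (hl : 2 ≤ l) :
    digitWeight r g l = (if l % 2 = 0 then r else g) * digitWeight r g (l / 2) := by
  rw [digitWeight, dif_neg (by omega)]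

theorem digitWeight_two_pow (r g : ℂ) (p : ℕ) : digitWeight r g (2 ^ p) = r ^ p := by
  induction p with
  | zero => simp [digitWeight_one]
  | succ p ih =>
    have := Nat.two_pow_pos p
    rw [digitWeight_of_two_le _ _ (by rw [pow_succ]; omega), pow_succ 2 p, if_pos (by omega),
      Nat.mul_div_cancel _ (by norm_num), ih, pow_succ']

/-- Prepending a digit 1 and k zeros adds k factors r; the former leading digit of m is no longer
leading and now contributes g. -/
theorem digitWeight_two_pow_add (r g : ℂ) (k : ℕ) {m : ℕ} (hm : 1 ≤ m) :
    digitWeight r g (2 ^ (Nat.log 2 m + k + 1) + m) = digitWeight r g m * (g * r ^ k) := by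
  induction m using Nat.strong_induction_on with
  | _ m ih =>
  have h0 := Nat.two_pow_pos (Nat.log 2 m + k)
  rw [digitWeight_of_two_le _ _ (by omega), pow_succ,
    show (2 ^ (Nat.log 2 m + k) * 2 + m) % 2 = m % 2 by omega,
    show (2 ^ (Nat.log 2 m + k) * 2 + m) / 2 = 2 ^ (Nat.log 2 m + k) + m / 2 by omega]
  rcases hm.eq_or_lt with h1 | h1
  · subst h1
    simp [digitWeight_one, digitWeight_two_pow]
  · have h2 : Nat.log 2 m = Nat.log 2 (m / 2) + 1 := by
      rw [Nat.log_div_base]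
      have := log_pos_of_two_le h1
      omega
    have h3 := ih (m / 2) (by omega) (by omega)
    rw [h2, show Nat.log 2 (m / 2) + 1 + k = Nat.log 2 (m / 2) + k + 1 by omega, h3,
      digitWeight_of_two_le _ _ h1]
    ring

theorem eq_digitWeight {r g : ℂ} {c : ℕ → ℂ} (hp : ∀ p, c (2 ^ p) = r ^ p)
    (ha : ∀ m k, 1 ≤ m → c (2 ^ (Nat.log 2 m + k + 1) + m) = c m * (g * r ^ k))
    {l : ℕ} (hl : 1 ≤ l) : c l = digitWeight r g l := by
  induction l using Nat.strong_induction_on with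
  | _ l ih =>
  rcases hl.eq_or_lt with h1 | h1
  · subst h1
    simpa [digitWeight_one] using hp 0
  rcases eq_two_pow_or_eq_add h1 with ⟨p, rfl⟩ | ⟨m, k, hm, rfl⟩
  · rw [hp, digitWeight_two_pow]
  · have := Nat.two_pow_pos (Nat.log 2 m + k + 1)
    rw [ha _ _ hm, digitWeight_two_pow_add _ _ _ hm, ih m (by omega) hm]

theorem digitWeight_eq_dropSecond (r g : ℂ) {l : ℕ} (hl : 2 ≤ l) :
    digitWeight r g l = digitWeight r g (dropSecond l) * if leadingPair l = 2 then r else g := by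
  rcases eq_two_pow_or_eq_add hl with ⟨p, rfl⟩ | ⟨m, k, hm, rfl⟩
  · rw [dropSecond_two_pow, leadingPair_two_pow, if_pos rfl, digitWeight_two_pow,
      digitWeight_two_pow, pow_succ]
  · rw [digitWeight_two_pow_add _ _ _ hm]
    cases k with
    | zero =>
      rw [dropSecond_two_pow_add_zero hm, leadingPair_two_pow_add_zero hm]
      simp
    | succ k =>
      rw [dropSecond_two_pow_add_succ, leadingPair_two_pow_add_succ, if_pos rfl,
        digitWeight_two_pow_add _ _ _ hm]
      ring

/-- The recursion by deletion of the second digit characterizes `digitWeight`. -/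
theorem eq_digitWeight_of_dropSecond {r g : ℂ} {c : ℕ → ℂ} (h1 : c 1 = 1)
    (hc : ∀ l, 2 ≤ l → c l = c (dropSecond l) * if leadingPair l = 2 then r else g)
    {l : ℕ} (hl : 1 ≤ l) : c l = digitWeight r g l := by
  induction l using Nat.strong_induction_on with
  | _ l ih =>
  rcases hl.eq_or_lt with h2 | h2
  · rw [← h2, h1, digitWeight_one]
  · rw [hc l h2, digitWeight_eq_dropSecond r g h2, ih _ (dropSecond_lt h2) (one_le_dropSecond l)]

theorem digitWeight_zero_left_two_pow_sub_one (g : ℂ) (p : ℕ) :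
    digitWeight 0 g (2 ^ (p + 1) - 1) = g ^ p := by
  induction p with
  | zero => simp [digitWeight_one]
  | succ p ih =>
    have h0 := Nat.two_pow_pos p
    have h1 : 2 ^ (p + 1 + 1) = 2 ^ (p + 1) * 2 := pow_succ _ _
    have h2 : 2 ^ (p + 1) = 2 ^ p * 2 := pow_succ _ _
    rw [digitWeight_of_two_le _ _ (by omega), if_neg (by omega),
      show (2 ^ (p + 1 + 1) - 1) / 2 = 2 ^ (p + 1) - 1 by omega, ih, pow_succ']

/-- With r = 0 a single digit 0 kills the weight, so only numbers made of ones survive. This is the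
support in type 3. -/
theorem digitWeight_zero_left_of_ne (g : ℂ) {l : ℕ} (hl : 1 ≤ l) (h : ∀ p, l ≠ 2 ^ p - 1) :
    digitWeight 0 g l = 0 := by
  induction l using Nat.strong_induction_on with
  | _ l ih =>
  have h1 : l ≠ 1 := by simpa using h 1
  rw [digitWeight_of_two_le _ _ (by omega)]
  by_cases h2 : l % 2 = 0
  · rw [if_pos h2, zero_mul]
  · rw [ih (l / 2) (by omega) (by omega), mul_zero]
    intro p hp
    apply h (p + 1)
    have := Nat.two_pow_pos p
    rw [pow_succ]
    omega

/-- With g = 0 a second digit 1 kills the weight. This is the support in type 4. -/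
theorem digitWeight_zero_right_of_ne (r : ℂ) {l : ℕ} (hl : 1 ≤ l) (h : ∀ p, l ≠ 2 ^ p) :
    digitWeight r 0 l = 0 := by
  induction l using Nat.strong_induction_on with
  | _ l ih =>
  have h1 : l ≠ 1 := by simpa using h 0
  rw [digitWeight_of_two_le _ _ (by omega)]
  by_cases h2 : l % 2 = 0
  · rw [ih (l / 2) (by omega) (by omega), mul_zero]
    intro p hp
    apply h (p + 1)
    rw [pow_succ]
    omega
  · rw [if_neg h2, zero_mul]

theorem digitWeight_zero_zero {l : ℕ} (hl : 2 ≤ l) : digitWeight 0 0 l = 0 := by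
  rw [digitWeight_of_two_le _ _ hl]
  simp

/-! ### Binary expansions and the product rule. -/

theorem exists_binary_expansion {m : ℕ} (hm : 1 ≤ m) :
    ∃ (s : ℕ) (e : ℕ → ℕ), (∀ i < s, e (i + 1) < e i) ∧
      m = ∑ i ∈ Finset.range (s + 1), 2 ^ e i := by
  induction m using Nat.strong_induction_on with
  | _ m ih =>
  rcases hm.eq_or_lt with h1 | h1
  · exact ⟨0, fun _ => 0, by simp, by simp [← h1]⟩
  rcases eq_two_pow_or_eq_add h1 with ⟨p, rfl⟩ | ⟨m, k, hm', rfl⟩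
  · exact ⟨0, fun _ => p + 1, by simp, by simp⟩
  · have := Nat.two_pow_pos (Nat.log 2 m + k + 1)
    obtain ⟨s, e, he, hme⟩ := ih m (by omega) hm'
    refine ⟨s + 1, fun i => Nat.casesOn i (Nat.log 2 m + k + 1) e, fun i hi => ?_, ?_⟩
    · cases i with
      | zero =>
        have h2 : 2 ^ e 0 ≤ m := by
          rw [hme]
          exact Finset.single_le_sum (f := fun i => 2 ^ e i) (fun _ _ => Nat.zero_le _)
            (Finset.mem_range.mpr (Nat.succ_pos s))
        have h3 : e 0 ≤ Nat.log 2 m := Nat.le_log_of_pow_le (by norm_num) h2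
        show e 0 < Nat.log 2 m + k + 1
        omega
      | succ i => exact he i (by omega)
    · rw [Finset.sum_range_succ', ← hme, add_comm]
      rfl

theorem log_sum_two_pow {s : ℕ} {e : ℕ → ℕ} (he : ∀ i < s, e (i + 1) < e i) :
    Nat.log 2 (∑ i ∈ Finset.range (s + 1), 2 ^ e i) = e 0 := by
  have key : 2 ^ e 0 ≤ ∑ i ∈ Finset.range (s + 1), 2 ^ e i ∧
      ∑ i ∈ Finset.range (s + 1), 2 ^ e i < 2 ^ (e 0 + 1) := by
    induction s generalizing e with
    | zero => simp [pow_succ]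
    | succ s ih =>
      have h1 := (ih (e := fun i => e (i + 1)) fun i hi => he (i + 1) (by omega)).2
      have h2 : 2 ^ (e 1 + 1) ≤ 2 ^ e 0 :=
        Nat.pow_le_pow_right (by norm_num) (he 0 (by omega))
      simp only [zero_add] at h1
      rw [Finset.sum_range_succ', pow_succ]
      omega
  exact Nat.log_eq_of_pow_le_of_lt_pow key.1 key.2

/-- The product rule, as a recursion on the leading binary digit. -/
theorem productRule_iff {C : ℕ → ℂ} (h1 : C 1 ≠ 0) :
    ProductRule C ↔ ∀ m k, 1 ≤ m →
      C (2 ^ (Nat.log 2 m + k + 1) + m) = C m * C (2 ^ (k + 1) + 1) / C 1 := by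
  -- The two branches of the rule are one formula: when the last exponent is 0, the extra factor C
  -- (2 ^ 0) = C 1 cancels one power of C 1.
  have hif : ∀ (s : ℕ) (e : ℕ → ℕ) (P : ℂ),
      (if e (s + 1) = 0 then (C 1 ^ (s + 1 - 1))⁻¹ * P
        else (C 1 ^ (s + 1))⁻¹ * P * C (2 ^ e (s + 1)))
        = (C 1 ^ (s + 1))⁻¹ * P * C (2 ^ e (s + 1)) := by
    intro s e P
    split_ifs with h
    · rw [h, pow_zero, Nat.add_sub_cancel, pow_succ]
      field_simp
    · rfl
  constructor
  · intro hP m k hm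
    obtain ⟨s, e, he, hme⟩ := exists_binary_expansion hm
    have hlog : Nat.log 2 m = e 0 := by rw [hme]; exact log_sum_two_pow he
    let e' : ℕ → ℕ := fun i => Nat.casesOn i (Nat.log 2 m + k + 1) e
    have he' : ∀ i < s + 1, e' (i + 1) < e' i := by
      intro i hi
      cases i with
      | zero => show e 0 < Nat.log 2 m + k + 1; omega
      | succ i => exact he i (by omega)
    have hl := hP (s + 1) e' (by omega) he'
    rw [hif s e', Finset.sum_range_succ', Finset.prod_range_succ'] at hl
    have e0 : e' 0 = Nat.log 2 m + k + 1 := rfl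
    have es : ∀ i, e' (i + 1) = e i := fun i => rfl
    simp only [e0, es, zero_add] at hl
    rw [← hme, add_comm, show Nat.log 2 m + k + 1 - e 0 = k + 1 by omega] at hl
    rw [hl]
    cases s with
    | zero =>
      have : m = 2 ^ e 0 := by simpa using hme
      simp [← this]
      field_simp
    | succ s =>
      have hl' := hP (s + 1) e (by omega) he
      rw [hif s e, ← hme] at hl'
      rw [hl', pow_succ _ (s + 1)]
      field_simp
  · intro hR s e hs he
    obtain ⟨s, rfl⟩ : ∃ s', s = s' + 1 := ⟨s - 1, by omega⟩
    rw [hif s e]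
    clear hs
    induction s generalizing e with
    | zero =>
      have h2 := hR (2 ^ e 1) (e 0 - e 1 - 1) Nat.one_le_two_pow
      have h3 := he 0 (by omega)
      rw [zero_add] at h3
      rw [Nat.log_pow (by norm_num), show e 1 + (e 0 - e 1 - 1) + 1 = e 0 by omega,
        show e 0 - e 1 - 1 + 1 = e 0 - e 1 by omega] at h2
      simp only [Finset.sum_range_succ, Finset.prod_range_succ, Finset.sum_range_zero,
        Finset.prod_range_zero, zero_add, pow_one, one_mul]
      rw [h2]
      field_simp
    | succ s ih =>
      have he1 : ∀ i < s + 1, e (i + 1 + 1) < e (i + 1) := fun i hi => he (i + 1) (by omega)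
      have h4 := ih (fun i => e (i + 1)) he1
      have h3 := he 0 (by omega)
      rw [zero_add] at h3
      have hm : 1 ≤ ∑ i ∈ Finset.range (s + 1 + 1), 2 ^ e (i + 1) :=
        le_trans Nat.one_le_two_pow
          (Finset.single_le_sum (f := fun i => 2 ^ e (i + 1)) (fun _ _ => Nat.zero_le _)
            (Finset.mem_range.mpr (Nat.succ_pos (s + 1))))
      have h2 := hR _ (e 0 - e 1 - 1) hm
      rw [log_sum_two_pow (e := fun i => e (i + 1)) he1, zero_add,
        show e 1 + (e 0 - e 1 - 1) + 1 = e 0 by omega,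
        show e 0 - e 1 - 1 + 1 = e 0 - e 1 by omega] at h2
      rw [Finset.sum_range_succ', add_comm, h2, h4,
        Finset.prod_range_succ' (fun i => C (2 ^ (e i - e (i + 1)) + 1)), pow_succ _ (s + 1)]
      simp only [zero_add]
      generalize (∏ k ∈ Finset.range (s + 1), C (2 ^ (e (k + 1) - e (k + 1 + 1)) + 1)) = P
      field_simp

/-! ### Colligations and the sufficiency of a realization. -/

/-- Up to normalization, the rows `(a₀, √D)`, `(a₁, √D r)`, `(b₀, √D g)` are orthogonal, with
squared norms `B`, `D`, `D`: a unitary colligation with one-dimensional state space. -/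
structure IsColligation (B D : ℝ) (a₀ a₁ b₀ : C2) (r g : ℂ) : Prop where
  pos : 0 < D
  norm_a₀ : ‖a₀‖ ^ 2 = B - D
  norm_a₁ : ‖a₁‖ ^ 2 = D * (1 - ‖r‖ ^ 2)
  norm_b₀ : ‖b₀‖ ^ 2 = D * (1 - ‖g‖ ^ 2)
  ip_a₁_a₀ : ip a₁ a₀ = -(D * r)
  ip_b₀_a₀ : ip b₀ a₀ = -(D * g)
  ip_a₁_b₀ : ip a₁ b₀ = -(D * r * conj g)

/-- The family `h` is given by the transfer function of the colligation. -/
structure IsRealization (h : ℕ → Hardy) (a₀ a₁ b₀ : C2) (r g : ℂ) : Prop where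
  eq_zero : EqFun (h 0) (fun ω => a₀ + (∑' k : ℕ, ω ^ (k + 1) * r ^ k) • a₁)
  eq_one : EqFun (h 1) (fun ω => b₀ + (∑' k : ℕ, ω ^ (k + 1) * r ^ k) • g • a₁)
  eq_smul : ∀ l, 1 ≤ l → h l = digitWeight r g l • h 1

namespace IsColligation

variable {B D : ℝ} {a₀ a₁ b₀ : C2} {r g : ℂ}

/-- If a₁ vanished, orthogonality to the first row would force r = 0, and the second row would then
have norm 0 instead of √D. Through `norm_r_lt_one` this makes the geometric series converge. -/
theorem a₁_ne_zero (H : IsColligation B D a₀ a₁ b₀ r g) : a₁ ≠ 0 := by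
  intro h
  have h1 := H.ip_a₁_a₀
  have h2 := H.norm_a₁
  have hD := H.pos
  rw [h, ip_zero_left, zero_eq_neg, mul_eq_zero, Complex.ofReal_eq_zero] at h1
  rw [h, h1.resolve_left hD.ne'] at h2
  simp at h2
  exact hD.ne' h2.symm

theorem norm_r_lt_one (H : IsColligation B D a₀ a₁ b₀ r g) : ‖r‖ < 1 := by
  have h1 : 0 < ‖a₁‖ ^ 2 := by
    have := norm_pos_iff.mpr H.a₁_ne_zero
    positivity
  rw [H.norm_a₁] at h1
  have h2 := pos_of_mul_pos_right h1 H.pos.le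
  nlinarith [norm_nonneg r]

end IsColligation

theorem norm_sq_eq (z : ℂ) : ((‖z‖ ^ 2 : ℝ) : ℂ) = z * conj z := by
  rw [Complex.mul_conj, Complex.normSq_eq_norm_sq]

/-- Put S = ω / (1 - ωr). Then 1 + rS = 1 / (1 - ωr) has the same modulus as S on the circle;
expanding |1 + rS|² = |S|² gives the identity. -/
theorem geometric_identity {r ω : ℂ} (hr : ‖r‖ < 1) (hω : ‖ω‖ = 1) :
    (1 - r * conj r) * ((ω * (1 - ω * r)⁻¹) * conj (ω * (1 - ω * r)⁻¹))
      - r * (ω * (1 - ω * r)⁻¹) - conj r * conj (ω * (1 - ω * r)⁻¹) = 1 := by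
  have h1 := one_sub_mul_ne_zero hr hω
  have h2 : conj (1 - ω * r) ≠ 0 := (map_ne_zero _).mpr h1
  have h3 : ω * conj ω = 1 := by rw [← norm_sq_eq, hω]; simp
  simp only [map_mul, map_sub, map_one, map_inv₀] at h2 ⊢
  have p := inv_mul_cancel₀ h1
  have p' := inv_mul_cancel₀ h2
  generalize (1 - ω * r)⁻¹ = P at *
  generalize (1 - conj ω * conj r)⁻¹ = P' at *
  linear_combination P * P' * h3 + (1 + conj ω * conj r * P') * p + P * p'

section Realization

variable {B D : ℝ} {h : ℕ → Hardy} {a₀ a₁ b₀ : C2} {r g : ℂ}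

theorem IsRealization.psi_one (R : IsRealization h a₀ a₁ b₀ r g) (hr : ‖r‖ < 1) :
    Psi h 1 = a₀ := by
  have h1 := (eqFun_geometric_iff _ _ _ hr).mp R.eq_zero
  rw [← h1.1, ← Psi_two_pow h 0, pow_zero]

theorem IsRealization.psi_of_two_le (R : IsRealization h a₀ a₁ b₀ r g) (hr : ‖r‖ < 1) {l : ℕ}
    (hl : 2 ≤ l) :
    Psi h l = digitWeight r g (dropSecond l) • if leadingPair l = 2 then a₁ else b₀ := by
  have h0 := (eqFun_geometric_iff _ _ _ hr).mp R.eq_zero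
  have h1 := (eqFun_geometric_iff _ _ _ hr).mp R.eq_one
  rcases eq_two_pow_or_eq_add hl with ⟨p, rfl⟩ | ⟨m, k, hm, rfl⟩
  · rw [Psi_two_pow, dropSecond_two_pow, leadingPair_two_pow, if_pos rfl, digitWeight_two_pow, h0.2]
  · rw [Psi_add h m k hm, R.eq_smul m hm, taylor_smul]
    cases k with
    | zero =>
      rw [dropSecond_two_pow_add_zero hm, leadingPair_two_pow_add_zero hm, h1.1]
      simp
    | succ k =>
      rw [dropSecond_two_pow_add_succ, leadingPair_two_pow_add_succ, if_pos rfl, h1.2,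
        digitWeight_two_pow_add _ _ _ hm, smul_smul, smul_smul]
      congr 1
      ring

/-- Induction along `dropSecond`: the orthogonality relations of the rows are exactly what turns the
recursion for β into multiplication of weights by r or g. -/
theorem beta_eq_of_realization (H : IsColligation B D a₀ a₁ b₀ r g)
    (R : IsRealization h a₀ a₁ b₀ r g) {l l' : ℕ} (hl : 1 ≤ l) (hl' : 1 ≤ l') :
    beta B h l l' = D * digitWeight r g l' * conj (digitWeight r g l) := by
  have hr := H.norm_r_lt_one
  have hbase : ∀ {l}, 2 ≤ l → beta B h l 1 = D * conj (digitWeight r g l) := by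
    intro l hl
    rw [beta_one_right B h hl, R.psi_one hr, R.psi_of_two_le hr hl, digitWeight_eq_dropSecond r g hl,
      ip_smul_right]
    split_ifs
    · rw [← ip_conj, H.ip_a₁_a₀]
      simp only [map_neg, map_mul, Complex.conj_ofReal]
      ring
    · rw [← ip_conj, H.ip_b₀_a₀]
      simp only [map_neg, map_mul, Complex.conj_ofReal]
      ring
  induction l using Nat.strong_induction_on generalizing l' with
  | _ l ih =>
  rcases hl.eq_or_lt with h1 | h1 <;> rcases hl'.eq_or_lt with h2 | h2
  · subst h1; subst h2
    rw [beta_one_one, R.psi_one hr, H.norm_a₀, digitWeight_one]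
    simp
  · subst h1
    rw [← beta_conj, hbase h2, digitWeight_one]
    simp
  · subst h2
    rw [hbase h1, digitWeight_one]
    ring
  · rw [beta_of_two_le B h h1 h2, ih _ (dropSecond_lt h1) (one_le_dropSecond l)
      (one_le_dropSecond l'), R.psi_of_two_le hr h1, R.psi_of_two_le hr h2,
      digitWeight_eq_dropSecond r g h1, digitWeight_eq_dropSecond r g h2, ip_smul_left,
      ip_smul_right]
    have e1 : ip a₁ a₁ = D * (1 - r * conj r) := by
      rw [ip_self, H.norm_a₁, ← norm_sq_eq]; push_cast; ring
    have e2 : ip b₀ b₀ = D * (1 - g * conj g) := by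
      rw [ip_self, H.norm_b₀, ← norm_sq_eq]; push_cast; ring
    have e3 := H.ip_a₁_b₀
    have e4 : ip b₀ a₁ = -(D * g * conj r) := by
      rw [← ip_conj, H.ip_a₁_b₀]
      simp only [map_neg, map_mul, Complex.conj_ofReal, Complex.conj_conj]
      ring
    rcases leadingPair_eq h1 with p1 | p1 <;> rcases leadingPair_eq h2 with p2 | p2 <;>
      rw [p1, p2] <;> simp only [e1, e2, e3, e4, map_mul, if_true, reduceIte, Nat.reduceEqDiff] <;>
      ring

theorem condH1_of_realization (H : IsColligation B D a₀ a₁ b₀ r g)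
    (R : IsRealization h a₀ a₁ b₀ r g) : CondH1 B h := by
  have hr := H.norm_r_lt_one
  have e0 : ip a₀ a₀ = B - D := by rw [ip_self, H.norm_a₀]; push_cast; ring
  have e1 : ip a₁ a₁ = D * (1 - r * conj r) := by
    rw [ip_self, H.norm_a₁, ← norm_sq_eq]; push_cast; ring
  have e2 : ip b₀ b₀ = D * (1 - g * conj g) := by
    rw [ip_self, H.norm_b₀, ← norm_sq_eq]; push_cast; ring
  have e3 := H.ip_a₁_b₀
  have e4 : ip b₀ a₁ = -(D * g * conj r) := by
    rw [← ip_conj, e3]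
    simp only [map_neg, map_mul, Complex.conj_ofReal, Complex.conj_conj]
    ring
  have e5 := H.ip_a₁_a₀
  have e6 : ip a₀ a₁ = -(D * conj r) := by
    rw [← ip_conj, e5]
    simp only [map_neg, map_mul, Complex.conj_ofReal]
  have e7 := H.ip_b₀_a₀
  have hmain : ∀ᵐ t ∂(haarAddCircle : Measure UnitAddCircle),
      ip (bd (h 0) t) (bd (h 0) t) = B ∧ ip (bd (h 1) t) (bd (h 1) t) = D ∧
        ip (bd (h 1) t) (bd (h 0) t) = 0 := by
    filter_upwards [R.eq_zero, R.eq_one] with t h0 h1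
    have hS := geometric_identity hr (norm_om t)
    rw [h0, h1, tsum_shifted_geometric hr (norm_om t)]
    generalize om t * (1 - om t * r)⁻¹ = S at hS ⊢
    simp only [ip_add_left, ip_add_right, ip_smul_left, ip_smul_right, e0, e1, e2, e3, e4, e5, e6,
      e7]
    -- The Gram entries of a₀, a₁, b₀ reduce each product to a constant plus a multiple of
    -- `geometric_identity`.
    refine ⟨?_, ?_, ?_⟩
    · linear_combination D * hS
    · linear_combination D * g * conj g * hS
    · linear_combination D * g * hS
  rw [condH1_iff]
  intro l l'
  rcases Nat.eq_zero_or_pos l with hl | hl <;> rcases Nat.eq_zero_or_pos l' with hl' | hl'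
  · subst hl; subst hl'
    filter_upwards [hmain] with t ht
    rw [ht.1, beta_zero_zero]
  · subst hl
    filter_upwards [hmain, bd_smul (digitWeight r g l') (h 1)] with t ht h2
    rw [R.eq_smul l' hl', h2, ip_smul_left, ht.2.2, beta_zero_left B h hl', mul_zero]
  · subst hl'
    filter_upwards [hmain, bd_smul (digitWeight r g l) (h 1)] with t ht h2
    rw [R.eq_smul l hl, h2, ip_smul_right, ← ip_conj, ht.2.2, beta_zero_right B h hl, map_zero,
      mul_zero]
  · filter_upwards [hmain, bd_smul (digitWeight r g l') (h 1),
      bd_smul (digitWeight r g l) (h 1)] with t ht h2 h3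
    rw [beta_eq_of_realization H R hl hl', R.eq_smul l' hl', h2, R.eq_smul l hl, h3, ip_smul_left,
      ip_smul_right, ht.2.1]
    ring

end Realization

/-! ### From (h1) to a realization. -/

theorem ip_eq_sum (x y : C2) : ip x y = x 0 * conj (y 0) + x 1 * conj (y 1) := by
  simp [ip, PiLp.inner_apply, Fin.sum_univ_two]

/-- The Gram determinant is the squared modulus of the determinant of x and y; once it is nonzero,
Cramer's rule gives both coordinates of w. -/
theorem eq_zero_of_ip_eq_zero {x y w : C2} (hx : ip x x ≠ 0) (hy : ip y y ≠ 0) (hxy : ip x y = 0)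
    (hwx : ip w x = 0) (hwy : ip w y = 0) : w = 0 := by
  have hyx : ip y x = 0 := by rw [← ip_conj, hxy, map_zero]
  have hdet : (x 0 * y 1 - x 1 * y 0) * conj (x 0 * y 1 - x 1 * y 0) = ip x x * ip y y := by
    have : ip x x * ip y y = ip x x * ip y y - ip x y * ip y x := by rw [hxy]; ring
    rw [this]
    simp only [ip_eq_sum, map_sub, map_mul]
    ring
  have hd : conj (x 0 * y 1 - x 1 * y 0) ≠ 0 := by
    intro h0
    rw [h0, mul_zero] at hdet
    exact mul_ne_zero hx hy hdet.symm
  rw [ip_eq_sum] at hwx hwy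
  ext i
  fin_cases i
  · refine (mul_eq_zero.mp (?_ : w 0 * conj (x 0 * y 1 - x 1 * y 0) = 0)).resolve_right hd
    simp only [map_sub, map_mul]
    linear_combination conj (y 1) * hwx - conj (x 1) * hwy
  · refine (mul_eq_zero.mp (?_ : w 1 * conj (x 0 * y 1 - x 1 * y 0) = 0)).resolve_right hd
    simp only [map_sub, map_mul]
    linear_combination conj (x 0) * hwy - conj (y 0) * hwx

/-- In the two-dimensional fibres, everything orthogonal to `𝔥₀` is proportional to `𝔥₁`. -/
theorem CondH1.eq_smul {B : ℝ} {h : ℕ → Hardy} (hB : 0 < B) (H : CondH1 B h)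
    (h11 : beta B h 1 1 ≠ 0) {l : ℕ} (hl : 1 ≤ l) :
    h l = (beta B h 1 l / beta B h 1 1) • h 1 := by
  rw [condH1_iff] at H
  refine Hardy.ext_bd ?_
  filter_upwards [H 0 0, H 1 1, H 1 0, H 0 l, H 1 l, bd_smul (beta B h 1 l / beta B h 1 1) (h 1)]
    with t h1 h2 h3 h4 h5 h6
  rw [h6, ← sub_eq_zero, sub_eq_add_neg, ← neg_smul]
  have hne : (B : ℂ) ≠ 0 := by exact_mod_cast hB.ne'
  rw [beta_zero_right B h le_rfl] at h3
  have h3' : ip (bd (h 1) t) (bd (h 0) t) = 0 := by rw [← ip_conj, h3, map_zero]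
  refine eq_zero_of_ip_eq_zero (x := bd (h 0) t) (y := bd (h 1) t) ?_ ?_ h3 ?_ ?_
  · rw [h1, beta_zero_zero]; exact hne
  · rw [h2]; exact h11
  · rw [ip_add_left, ip_smul_left, h3', h4, beta_zero_left B h hl]; ring
  · rw [ip_add_left, ip_smul_left, h2, h5]
    field_simp
    ring

theorem CondH1.beta_eq {B : ℝ} {h : ℕ → Hardy} (hB : 0 < B) (H : CondH1 B h)
    (h11 : beta B h 1 1 ≠ 0) {l l' : ℕ} (hl : 1 ≤ l) (hl' : 1 ≤ l') :
    beta B h l l' = beta B h 1 1 * (beta B h 1 l' / beta B h 1 1)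
      * conj (beta B h 1 l / beta B h 1 1) := by
  have e1 := H.eq_smul hB h11 hl
  have e2 := H.eq_smul hB h11 hl'
  rw [condH1_iff] at H
  obtain ⟨t, h1, h2, h3, h4⟩ := ((H l l').and ((H 1 1).and
    ((bd_smul (beta B h 1 l / beta B h 1 1) (h 1)).and
      (bd_smul (beta B h 1 l' / beta B h 1 1) (h 1))))).exists
  rw [e1, e2, h3, h4, ip_smul_left, ip_smul_right, h2] at h1
  rw [← h1]
  ring

theorem CondH1.beta_self_nonneg {B : ℝ} {h : ℕ → Hardy} (H : CondH1 B h) (l : ℕ) :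
    ∃ b : ℝ, 0 ≤ b ∧ beta B h l l = b := by
  rw [condH1_iff] at H
  obtain ⟨t, ht⟩ := (H l l).exists
  exact ⟨‖bd (h l) t‖ ^ 2, by positivity, by rw [← ht, ip_self]⟩

/-- Here Ψ_1 already exhausts B. Since Ψ_1 occurs in the sum defining every β_{l,l}, this gives
β_{l,l} ≤ -‖Ψ_l‖² for l ≥ 2, while β_{l,l} ≥ 0 as a squared norm; both sides vanish. -/
theorem CondH1.isType1 {B : ℝ} {h : ℕ → Hardy} (hB : 0 < B) (H : CondH1 B h)
    (h11 : beta B h 1 1 = 0) : IsType1 B h := by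
  rw [beta_one_one, Complex.ofReal_eq_zero, sub_eq_zero] at h11
  have hb : ∀ l, 2 ≤ l → ∃ b : ℝ, 0 ≤ b ∧ beta B h l l = b ∧ b ≤ -‖Psi h l‖ ^ 2 := by
    intro l hl
    obtain ⟨b, hb0, hb⟩ := H.beta_self_nonneg l
    refine ⟨b, hb0, hb, ?_⟩
    have hlog := log_pos_of_two_le hl
    have h0 : l ≠ 0 := by omega
    have h1 : beta B h l l
        = ((B - ∑ j ∈ Finset.range (Nat.log 2 l + 1), ‖Psi h (trunc l j)‖ ^ 2 : ℝ) : ℂ) := by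
      simp [beta, h0]
    rw [h1, Complex.ofReal_inj, Finset.sum_range_succ, trunc_log (by omega)] at hb
    have h2 : ‖Psi h 1‖ ^ 2 ≤ ∑ j ∈ Finset.range (Nat.log 2 l), ‖Psi h (trunc l j)‖ ^ 2 := by
      have := Finset.single_le_sum (f := fun j => ‖Psi h (trunc l j)‖ ^ 2)
        (fun _ _ => by positivity) (Finset.mem_range.mpr hlog)
      simpa [trunc_zero] using this
    linarith
  have hpsi : ∀ l, 2 ≤ l → Psi h l = 0 := by
    intro l hl
    obtain ⟨b, hb0, -, hb⟩ := hb l hl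
    have : ‖Psi h l‖ ^ 2 = 0 := le_antisymm (by linarith) (by positivity)
    simpa using this
  have hbeta : ∀ l, 1 ≤ l → beta B h l l = 0 := by
    intro l hl
    rcases hl.eq_or_lt with h1 | h1
    · rw [← h1, beta_one_one, h11]; simp
    · obtain ⟨b, hb0, hbe, hb⟩ := hb l h1
      rw [hpsi l h1] at hb
      have : b = 0 := le_antisymm (by simpa using hb) hb0
      rw [hbe, this, Complex.ofReal_zero]
  have hne : taylor (h 0) 0 ≠ 0 := by
    intro h0
    rw [← Psi_two_pow h 0, pow_zero] at h0
    rw [h0] at h11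
    simp at h11
    exact hB.ne' h11
  have hnorm : ‖taylor (h 0) 0‖ ^ 2 = B := by
    rw [← Psi_two_pow h 0, pow_zero, h11]
  refine ⟨((‖taylor (h 0) 0‖ : ℂ)⁻¹) • taylor (h 0) 0, ‖taylor (h 0) 0‖, ?_, ?_, ?_, ?_⟩
  · rw [norm_smul, norm_inv, Complex.norm_real, norm_norm, inv_mul_cancel₀ (norm_ne_zero_iff.mpr hne)]
  · rw [Complex.norm_real, norm_norm, hnorm]
  · have hc : (‖taylor (h 0) 0‖ : ℂ) ≠ 0 := by exact_mod_cast norm_ne_zero_iff.mpr hne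
    refine ((eqFun_geometric_iff (h 0) (taylor (h 0) 0) 0 (r := 0) (by simp)).mpr
      ⟨rfl, fun k => ?_⟩).congr fun ω _ => ?_
    · have := Nat.two_pow_pos k
      rw [smul_zero, ← Psi_two_pow, hpsi _ (by rw [pow_succ]; omega)]
    · rw [smul_zero, add_zero, smul_smul, mul_inv_cancel₀ hc, one_smul]
  · intro l hl
    refine Hardy.ext_bd ?_
    filter_upwards [(condH1_iff B h).mp H l l, bd_zero] with t h1 h2
    rw [h2]
    rw [hbeta l hl, ip_self, Complex.ofReal_eq_zero] at h1
    simpa using h1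

theorem CondH1.exists_realization {B : ℝ} {h : ℕ → Hardy} (hB : 0 < B) (H : CondH1 B h)
    (h11 : beta B h 1 1 ≠ 0) :
    ∃ (D : ℝ) (a₀ a₁ b₀ : C2) (r g : ℂ),
      IsColligation B D a₀ a₁ b₀ r g ∧ IsRealization h a₀ a₁ b₀ r g := by
  obtain ⟨D, hD0, hD⟩ := H.beta_self_nonneg 1
  have hDne : (D : ℂ) ≠ 0 := by rw [← hD]; exact h11
  have hDpos : 0 < D := lt_of_le_of_ne hD0 fun h0 => hDne (by rw [← h0]; simp)
  have hsmul := fun l (hl : 1 ≤ l) => H.eq_smul hB h11 hl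
  have hbeta := fun l l' (hl : 1 ≤ l) (hl' : 1 ≤ l') => H.beta_eq hB h11 hl hl'
  rw [hD] at hsmul hbeta
  set c : ℕ → ℂ := fun l => beta B h 1 l / D with hc
  have hc1 : c 1 = 1 := by rw [hc]; simp only; rw [hD, div_self hDne]
  -- The recursion for β with rank one inserted: moving the term D c_{l'} conj(c_l) to the left
  -- gives the scalar product of w_{l'} and w_l, where w_l = (Ψ_l, √D c_l).
  have gram : ∀ l l', 2 ≤ l → 2 ≤ l' → ip (Psi h l') (Psi h l) = -(D * c l' * conj (c l)) +
      if leadingPair l = leadingPair l' then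
        D * c (dropSecond l') * conj (c (dropSecond l)) else 0 := by
    intro l l' hl hl'
    have h1 := hbeta l l' (by omega) (by omega)
    rw [beta_of_two_le B h hl hl',
      hbeta _ _ (one_le_dropSecond l) (one_le_dropSecond l')] at h1
    linear_combination -h1
  have gram_one : ∀ l, 2 ≤ l → ip (Psi h l) (Psi h 1) = -(D * c l) := by
    intro l hl
    have h1 := hbeta l 1 (by omega) le_rfl
    change _ = D * c 1 * conj (c l) at h1
    rw [beta_one_right B h hl, hc1] at h1
    rw [← ip_conj, show ip (Psi h 1) (Psi h l) = -(D * conj (c l)) by linear_combination -h1]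
    simp
  -- Used with m = 2 (digits 10) and m = 3 (digits 11). By the Gram formula w_l - c_{l₁} w_m, with
  -- l₁ = `dropSecond l`, has norm zero, so both its ℂ² component and its scalar component vanish.
  have step : ∀ l m, 2 ≤ l → 2 ≤ m → leadingPair l = leadingPair m → dropSecond m = 1 →
      Psi h l = c (dropSecond l) • Psi h m ∧ c l = c (dropSecond l) * c m := by
    intro l m hl hm hlm hm1
    have g1 := gram l l hl hl
    have g2 := gram l m hl hm
    have g3 := gram m l hm hl
    have g4 := gram m m hm hm
    rw [if_pos rfl] at g1
    rw [if_pos hlm, hm1, hc1] at g2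
    rw [if_pos hlm.symm, hm1, hc1] at g3
    rw [if_pos rfl, hm1, hc1] at g4
    have key : ip (Psi h l + (-c (dropSecond l)) • Psi h m)
        (Psi h l + (-c (dropSecond l)) • Psi h m)
        + D * ((c l - c (dropSecond l) * c m) * conj (c l - c (dropSecond l) * c m)) = 0 := by
      simp only [ip_add_left, ip_add_right, ip_smul_left, ip_smul_right, g1, g2, g3, g4, map_sub,
        map_mul, map_neg, map_one]
      ring
    rw [ip_self, ← norm_sq_eq, ← Complex.ofReal_mul, ← Complex.ofReal_add,
      Complex.ofReal_eq_zero] at key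
    have n1 : 0 ≤ ‖Psi h l + (-c (dropSecond l)) • Psi h m‖ ^ 2 := by positivity
    have n2 : 0 ≤ D * ‖c l - c (dropSecond l) * c m‖ ^ 2 := by positivity
    have z1 : ‖Psi h l + (-c (dropSecond l)) • Psi h m‖ ^ 2 = 0 := by linarith
    have z2 : D * ‖c l - c (dropSecond l) * c m‖ ^ 2 = 0 := by linarith
    constructor
    · rw [sq_eq_zero_iff, norm_eq_zero, neg_smul, ← sub_eq_add_neg, sub_eq_zero] at z1
      exact z1
    · rw [mul_eq_zero, sq_eq_zero_iff, norm_eq_zero, sub_eq_zero] at z2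
      exact z2.resolve_left hDpos.ne'
  have d2 : dropSecond 2 = 1 := dropSecond_two_pow 0
  have p2 : leadingPair 2 = 2 := leadingPair_two_pow 0
  have d3 : dropSecond 3 = 1 := by simpa using dropSecond_two_pow_add_zero (m := 1) le_rfl
  have p3 : leadingPair 3 = 3 := by simpa using leadingPair_two_pow_add_zero (m := 1) le_rfl
  have hw : ∀ l, 1 ≤ l → c l = digitWeight (c 2) (c 3) l := by
    intro l hl
    refine eq_digitWeight_of_dropSecond hc1 (fun l hl => ?_) hl
    rcases leadingPair_eq hl with hp | hp
    · rw [hp, if_pos rfl]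
      exact (step l 2 hl le_rfl (hp.trans p2.symm) d2).2
    · rw [hp, if_neg (by norm_num)]
      exact (step l 3 hl (by norm_num) (hp.trans p3.symm) d3).2
  have g22 := gram 2 2 le_rfl le_rfl
  have g33 := gram 3 3 (by norm_num) (by norm_num)
  have g32 := gram 3 2 (by norm_num) le_rfl
  rw [if_pos rfl, d2, hc1, ip_self, mul_assoc, ← norm_sq_eq] at g22
  rw [if_pos rfl, d3, hc1, ip_self, mul_assoc, ← norm_sq_eq] at g33
  rw [p3, p2, if_neg (by norm_num), add_zero] at g32
  have hcol : IsColligation B D (Psi h 1) (Psi h 2) (Psi h 3) (c 2) (c 3) :=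
    { pos := hDpos
      norm_a₀ := by
        rw [beta_one_one, Complex.ofReal_inj] at hD
        linarith
      norm_a₁ := by
        simp only [map_one, mul_one] at g22
        have : ‖Psi h 2‖ ^ 2 = -(D * ‖c 2‖ ^ 2) + D := by exact_mod_cast g22
        linarith
      norm_b₀ := by
        simp only [map_one, mul_one] at g33
        have : ‖Psi h 3‖ ^ 2 = -(D * ‖c 3‖ ^ 2) + D := by exact_mod_cast g33
        linarith
      ip_a₁_a₀ := gram_one 2 le_rfl
      ip_b₀_a₀ := gram_one 3 (by norm_num)
      ip_a₁_b₀ := g32 }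
  have hr := hcol.norm_r_lt_one
  refine ⟨D, Psi h 1, Psi h 2, Psi h 3, c 2, c 3, hcol, ?_, ?_, fun l hl => ?_⟩
  · refine (eqFun_geometric_iff _ _ _ hr).mpr ⟨(Psi_two_pow h 0).symm, fun k => ?_⟩
    have hk : 2 ≤ 2 ^ (k + 1) := by have := Nat.two_pow_pos k; rw [pow_succ]; omega
    have := (step (2 ^ (k + 1)) 2 hk le_rfl
      ((leadingPair_two_pow k).trans p2.symm) d2).1
    rw [← Psi_two_pow, this, dropSecond_two_pow, hw _ Nat.one_le_two_pow, digitWeight_two_pow]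
  · refine (eqFun_geometric_iff _ _ _ hr).mpr ⟨?_, fun k => ?_⟩
    · simpa using (Psi_add h 1 0 le_rfl).symm
    · have h0 := Nat.two_pow_pos (Nat.log 2 1 + (k + 1))
      have hk : 2 ≤ 2 ^ (Nat.log 2 1 + (k + 1) + 1) + 1 := by rw [pow_succ]; omega
      have := (step _ 2 hk le_rfl ((leadingPair_two_pow_add_succ 1 k).trans p2.symm) d2).1
      rw [← Psi_add h 1 (k + 1) le_rfl, this, dropSecond_two_pow_add_succ, hw _ (Nat.le_add_left 1 _),
        digitWeight_two_pow_add _ _ _ le_rfl, digitWeight_one, smul_smul]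
      congr 1
      ring
  · rw [← hw l hl]
    exact hsmul l hl

/-! ### From a realization to the types. -/

theorem exists_unit_vector {a : C2} (ha : a ≠ 0) : ∃ u : C2, ‖u‖ = 1 ∧ a = (‖a‖ : ℂ) • u := by
  have hc : (‖a‖ : ℂ) ≠ 0 := by exact_mod_cast norm_ne_zero_iff.mpr ha
  refine ⟨(‖a‖ : ℂ)⁻¹ • a, ?_, by rw [smul_smul, mul_inv_cancel₀ hc, one_smul]⟩
  rw [norm_smul, norm_inv, Complex.norm_real, norm_norm, inv_mul_cancel₀ (norm_ne_zero_iff.mpr ha)]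

theorem tsum_geometric_zero (ω : ℂ) : ∑' k : ℕ, ω ^ (k + 1) * (0 : ℂ) ^ k = ω := by
  rw [tsum_eq_single 0 fun k hk => by rw [zero_pow hk, mul_zero]]
  simp

theorem ofReal_norm_sq {z : ℂ} {b : ℝ} (h : ‖z‖ ^ 2 = b) : z * conj z = b := by
  rw [← norm_sq_eq, h]

section Parametrize

variable {B D : ℝ} {h : ℕ → Hardy} {a₀ a₁ b₀ : C2} {r g : ℂ}

theorem IsColligation.b₀_ne_zero (H : IsColligation B D a₀ a₁ b₀ r g) : b₀ ≠ 0 := by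
  intro h
  have h1 := H.ip_b₀_a₀
  have h2 := H.norm_b₀
  have hD := H.pos
  rw [h, ip_zero_left, zero_eq_neg, mul_eq_zero, Complex.ofReal_eq_zero] at h1
  rw [h, h1.resolve_left hD.ne'] at h2
  simp at h2
  exact hD.ne' h2.symm

theorem isType2_of_realization (H : IsColligation B D a₀ a₁ b₀ r g)
    (R : IsRealization h a₀ a₁ b₀ r g) (ha : a₀ = 0) : IsType2 B h := by
  have hD := H.pos
  have hDc : (D : ℂ) ≠ 0 := by exact_mod_cast hD.ne'
  have hDB : D = B := by
    have := H.norm_a₀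
    rw [ha] at this
    simp at this
    linarith
  subst ha
  have hr : r = 0 := by
    have := H.ip_a₁_a₀
    rw [ip_zero_right, zero_eq_neg, mul_eq_zero] at this
    exact this.resolve_left hDc
  have hg : g = 0 := by
    have := H.ip_b₀_a₀
    rw [ip_zero_right, zero_eq_neg, mul_eq_zero] at this
    exact this.resolve_left hDc
  subst hr hg hDB
  obtain ⟨u₀, hu₀, ha₁⟩ := exists_unit_vector H.a₁_ne_zero
  obtain ⟨u₁, hu₁, hb₀⟩ := exists_unit_vector H.b₀_ne_zero
  have hα : (‖a₁‖ : ℂ) ≠ 0 := by exact_mod_cast norm_ne_zero_iff.mpr H.a₁_ne_zero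
  have hβ : (‖b₀‖ : ℂ) ≠ 0 := by exact_mod_cast norm_ne_zero_iff.mpr H.b₀_ne_zero
  refine ⟨u₀, u₁, ‖a₁‖, ‖b₀‖, ⟨hu₀, hu₁, ?_⟩, ?_, ?_, ?_, ?_, ?_⟩
  · have := H.ip_a₁_b₀
    rw [ha₁, hb₀, ip_smul_left, ip_smul_right, Complex.conj_ofReal] at this
    simpa [H.a₁_ne_zero, H.b₀_ne_zero] using this
  · rw [Complex.norm_real, norm_norm, H.norm_a₁]; simp
  · rw [Complex.norm_real, norm_norm, H.norm_b₀]; simp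
  · refine R.eq_zero.congr fun ω _ => ?_
    rw [tsum_geometric_zero, zero_add, ← ha₁]
  · refine R.eq_one.congr fun ω _ => ?_
    rw [zero_smul, smul_zero, add_zero, ← hb₀]
  · intro l hl
    rw [R.eq_smul l (by omega), digitWeight_zero_zero hl, zero_smul]

theorem isType3_of_realization (hB : 0 < B) (H : IsColligation B D a₀ a₁ b₀ r g)
    (R : IsRealization h a₀ a₁ b₀ r g) (ha : a₀ ≠ 0) (hr : r = 0) : IsType3 B h := by
  subst hr
  have hD := H.pos
  obtain ⟨u₀, hu₀, ha₀⟩ := exists_unit_vector ha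
  obtain ⟨u₁, hu₁, ha₁⟩ := exists_unit_vector H.a₁_ne_zero
  have hα : 0 < ‖a₀‖ := norm_pos_iff.mpr ha
  have hβ : 0 < ‖a₁‖ := norm_pos_iff.mpr H.a₁_ne_zero
  have hα2 := H.norm_a₀
  have hβ2 : ‖a₁‖ ^ 2 = D := by rw [H.norm_a₁]; simp
  have hγ2 := H.norm_b₀
  have hip := H.ip_a₁_a₀
  have hipb := H.ip_b₀_a₀
  have hipab := H.ip_a₁_b₀
  generalize ‖a₀‖ = α at *
  generalize ‖a₁‖ = β at *
  have hαc : (α : ℂ) ≠ 0 := by exact_mod_cast hα.ne'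
  have hβc : (β : ℂ) ≠ 0 := by exact_mod_cast hβ.ne'
  subst ha₀ ha₁
  have huu : ip u₁ u₀ = 0 := by
    rw [ip_smul_left, ip_smul_right, Complex.conj_ofReal] at hip
    simpa [hαc, hβc] using hip
  have huu' : ip u₀ u₁ = 0 := by rw [← ip_conj, huu, map_zero]
  have hub : ip b₀ u₁ = 0 := by
    rw [ip_smul_left] at hipab
    rw [← ip_conj, map_eq_zero]
    simpa [hβc] using hipab
  have hu₀1 : ip u₀ u₀ = 1 := by rw [ip_self, hu₀]; simp
  have hu₁1 : ip u₁ u₁ = 1 := by rw [ip_self, hu₁]; simp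
  -- For r = 0 both a₀ and b₀ are orthogonal to a₁, hence parallel in ℂ².
  obtain ⟨μ, hμ⟩ : ∃ μ : ℂ, b₀ = μ • u₀ := by
    refine ⟨ip b₀ u₀, ?_⟩
    rw [← sub_eq_zero, sub_eq_add_neg, ← neg_smul]
    refine eq_zero_of_ip_eq_zero (x := u₀) (y := u₁) ?_ ?_ huu' ?_ ?_
    · rw [hu₀1]; exact one_ne_zero
    · rw [hu₁1]; exact one_ne_zero
    · rw [ip_add_left, ip_smul_left, hu₀1]; ring
    · rw [ip_add_left, ip_smul_left, hub, huu']; ring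
  subst hμ
  have hμg : μ * α = -(D * g) := by
    rw [ip_smul_left, ip_smul_right, hu₀1, Complex.conj_ofReal] at hipb
    linear_combination hipb
  have hμn : ‖μ‖ ^ 2 * (B - D) = D ^ 2 * ‖g‖ ^ 2 := by
    have := congrArg (fun z => ‖z‖ ^ 2) hμg
    simp only [norm_mul, norm_neg, Complex.norm_real, mul_pow, Real.norm_eq_abs, sq_abs] at this
    rw [← hα2]
    exact this
  rw [norm_smul, hu₀, mul_one] at hγ2
  -- |μ|² is computed from the norm of b₀ and again from its product with a₀; equating the two
  -- determines |g|.
  have hgn : 1 - ‖g‖ ^ 2 = D / B := by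
    rw [hγ2] at hμn
    rw [eq_div_iff hB.ne']
    have : D * ((1 - ‖g‖ ^ 2) * B - D) = 0 := by linear_combination hμn
    have := (mul_eq_zero.mp this).resolve_left hD.ne'
    linarith
  set s : ℝ := √B with hs
  have hs0 : 0 < s := Real.sqrt_pos.mpr hB
  have hs2 : s ^ 2 = B := Real.sq_sqrt hB.le
  set σ : ℝ := β / s with hσ
  have hσ0 : 0 < σ := by positivity
  have hρσ : 1 - (α / s) ^ 2 = σ ^ 2 := by
    rw [hσ, div_pow, div_pow, hs2, hα2, hβ2]
    field_simp
    ring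
  have hsq : √(1 - (α / s) ^ 2) = σ := by rw [hρσ, Real.sqrt_sq hσ0.le]
  have hsc : (s : ℂ) ≠ 0 := by exact_mod_cast hs0.ne'
  have hσc : (σ : ℂ) ≠ 0 := by exact_mod_cast hσ0.ne'
  have hDc : (D : ℂ) ≠ 0 := by exact_mod_cast hD.ne'
  have hβσ : (β : ℂ) = s * σ := by rw [hσ]; push_cast; field_simp
  have hDσ : (D : ℂ) = s ^ 2 * σ ^ 2 := by
    rw [← hβ2]; push_cast; rw [hβσ]; ring
  have hg : g = -(μ * α) / (s ^ 2 * σ ^ 2) := by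
    rw [← hDσ, eq_div_iff hDc]
    linear_combination hμg
  have hμ2 : ‖μ‖ ^ 2 = D * σ ^ 2 := by
    rw [hγ2, hgn, hσ, div_pow, hβ2, hs2]
  have hμμ : μ * conj μ = s ^ 2 * σ ^ 4 := by
    rw [ofReal_norm_sq hμ2]; push_cast; rw [hDσ]; ring
  have hμ0 : μ ≠ 0 := by
    intro h0
    rw [h0, zero_mul] at hμμ
    exact mul_ne_zero (pow_ne_zero 2 hsc) (pow_ne_zero 4 hσc) hμμ.symm
  have hμ0' : conj μ ≠ 0 := (map_ne_zero _).mpr hμ0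
  have hone : EqFun (h 1) (fun ω => (μ / σ * Complex.exp ((0 : ℝ) * Complex.I)) •
        (((√(1 - (α / s) ^ 2) : ℝ) : ℂ) • u₀ - (ω * (α / s : ℝ)) • u₁)) := by
    refine R.eq_one.congr fun ω _ => ?_
    rw [tsum_geometric_zero, hsq, hg, hβσ]
    simp only [Complex.ofReal_zero, zero_mul, Complex.exp_zero, mul_one, sub_eq_add_neg,
      smul_add, ← neg_smul, smul_smul]
    congr 2
    · field_simp
    · push_cast
      field_simp
  -- The phases of a₀ and a₁ sit in u₀ and u₁, so B₀ = √B is real; the phase of b₀ sits in C₁ = μ /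
  -- σ, so θ = 0 suffices.
  refine ⟨u₀, u₁, α / s, 0, s, μ / σ, ⟨hu₀, hu₁, huu'⟩, by positivity, ?_, ?_, ?_, ?_, hone, ?_, ?_⟩
  · have : (α / s) ^ 2 < 1 := by nlinarith
    nlinarith [div_pos hα hs0]
  · rw [Complex.norm_real, Real.norm_eq_abs, sq_abs, hs2]
  · rw [norm_div, div_pow, hμ2, hρσ, Complex.norm_real, Real.norm_eq_abs, sq_abs, hσ, div_pow, hβ2,
      hs2]
    field_simp
  · refine R.eq_zero.congr fun ω _ => ?_
    rw [tsum_geometric_zero, hsq, hβσ]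
    simp only [smul_add, smul_smul]
    congr 2
    · push_cast
      field_simp
    · ring
  · intro p hp
    have hl : 1 ≤ 2 ^ p - 1 := by
      obtain ⟨q, rfl⟩ : ∃ q, p = q + 1 := ⟨p - 1, by omega⟩
      have := Nat.two_pow_pos q
      rw [pow_succ]
      omega
    obtain ⟨q, rfl⟩ : ∃ q, p = q + 1 := ⟨p - 1, by omega⟩
    rw [R.eq_smul _ hl, digitWeight_zero_left_two_pow_sub_one, Nat.add_sub_cancel]
    refine (hone.smul _).congr fun ω _ => ?_
    rw [smul_smul, ← mul_assoc]
    congr 3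
    rw [hsq, hg]
    congr 1
    simp only [Complex.ofReal_zero, zero_mul, Complex.exp_zero, mul_one, map_div₀,
      Complex.conj_ofReal]
    push_cast
    field_simp
    linear_combination (-1 : ℂ) * hμμ
  · intro l hl hne
    rw [R.eq_smul l hl, digitWeight_zero_left_of_ne g hl hne, zero_smul]

theorem isType5_of_realization (hB : 0 < B) (H : IsColligation B D a₀ a₁ b₀ r g)
    (R : IsRealization h a₀ a₁ b₀ r g) (hr : r ≠ 0) : IsType5 B h := by
  have hD := H.pos
  have hDc : (D : ℂ) ≠ 0 := by exact_mod_cast hD.ne'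
  have ha : a₀ ≠ 0 := by
    intro h0
    have := H.ip_a₁_a₀
    rw [h0, ip_zero_right, zero_eq_neg, mul_eq_zero] at this
    exact this.elim hDc hr
  obtain ⟨u₀, hu₀, ha₀⟩ := exists_unit_vector ha
  obtain ⟨v, hv, ha₁⟩ := exists_unit_vector H.a₁_ne_zero
  obtain ⟨u₁, hu₁, hb₀⟩ := exists_unit_vector H.b₀_ne_zero
  have hα : 0 < ‖a₀‖ := norm_pos_iff.mpr ha
  have hβ : 0 < ‖a₁‖ := norm_pos_iff.mpr H.a₁_ne_zero
  have hγ : 0 < ‖b₀‖ := norm_pos_iff.mpr H.b₀_ne_zero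
  have hα2 := H.norm_a₀
  have hβ2 := H.norm_a₁
  have hγ2 := H.norm_b₀
  have hx := H.ip_a₁_a₀
  have hy := H.ip_b₀_a₀
  have hz := H.ip_a₁_b₀
  generalize ‖a₀‖ = α at *
  generalize ‖a₁‖ = β at *
  generalize ‖b₀‖ = γ at *
  have hαc : (α : ℂ) ≠ 0 := by exact_mod_cast hα.ne'
  have hβc : (β : ℂ) ≠ 0 := by exact_mod_cast hβ.ne'
  have hγc : (γ : ℂ) ≠ 0 := by exact_mod_cast hγ.ne'
  subst ha₀ ha₁ hb₀
  rw [ip_smul_left, ip_smul_right, Complex.conj_ofReal] at hx hy hz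
  have ex : ip u₀ v = conj (ip v u₀) := (ip_conj _ _).symm
  have ey : ip u₀ u₁ = conj (ip u₁ u₀) := (ip_conj _ _).symm
  have ez : ip u₁ v = conj (ip v u₁) := (ip_conj _ _).symm
  have hx' := congrArg conj hx
  have hy' := congrArg conj hy
  have hz' := congrArg conj hz
  simp only [map_mul, map_neg, Complex.conj_ofReal, Complex.conj_conj] at hx' hy' hz'
  have hxn : β ^ 2 * α ^ 2 * ‖ip v u₀‖ ^ 2 = D ^ 2 * ‖r‖ ^ 2 := by
    have := congrArg (fun z => ‖z‖ ^ 2) hx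
    simp only [norm_mul, norm_neg, Complex.norm_real, mul_pow, Real.norm_eq_abs, sq_abs] at this
    linarith
  have hyn : γ ^ 2 * α ^ 2 * ‖ip u₁ u₀‖ ^ 2 = D ^ 2 * ‖g‖ ^ 2 := by
    have := congrArg (fun z => ‖z‖ ^ 2) hy
    simp only [norm_mul, norm_neg, Complex.norm_real, mul_pow, Real.norm_eq_abs, sq_abs] at this
    linarith
  have hx0 : ip u₀ v ≠ 0 := by
    rw [ex, map_ne_zero]
    intro h0
    rw [h0, mul_zero, mul_zero, zero_eq_neg, mul_eq_zero] at hx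
    exact hx.elim hDc hr
  set s : ℝ := √B with hs
  have hs0 : 0 < s := Real.sqrt_pos.mpr hB
  have hs2 : s ^ 2 = B := Real.sq_sqrt hB.le
  set d : ℝ := √D with hd
  have hd0 : 0 < d := Real.sqrt_pos.mpr hD
  have hd2 : d ^ 2 = D := Real.sq_sqrt hD.le
  have hsc : (s : ℂ) ≠ 0 := by exact_mod_cast hs0.ne'
  have hdc : (d : ℂ) ≠ 0 := by exact_mod_cast hd0.ne'
  have hs2c : (s : ℂ) ^ 2 = B := by exact_mod_cast hs2
  have hd2c : (d : ℂ) ^ 2 = D := by exact_mod_cast hd2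
  have hρ : ‖(α / s : ℂ)‖ ^ 2 = α ^ 2 / B := by
    rw [norm_div, div_pow, Complex.norm_real, Complex.norm_real, Real.norm_eq_abs, sq_abs,
      Real.norm_eq_abs, sq_abs, hs2]
  have hρ1 : 1 - ‖(α / s : ℂ)‖ ^ 2 = D / B := by
    rw [hρ, hα2]; field_simp; ring
  have hκ : ‖(α / s : ℂ)‖ ^ 2 / (1 - ‖(α / s : ℂ)‖ ^ 2) = α ^ 2 / D := by
    rw [hρ1, hρ]; field_simp
  -- This combines ‖a₁‖² + D|r|² = D with |⟨a₁, a₀⟩| = D|r|; the next identity does the same for b₀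
  -- and g.
  have hX : 1 + α ^ 2 / D * ‖ip v u₀‖ ^ 2 = D / β ^ 2 := by
    have hβ0 : β ≠ 0 := hβ.ne'
    field_simp
    linear_combination hxn + D * hβ2
  have hY : 1 + α ^ 2 / D * ‖ip u₁ u₀‖ ^ 2 = D / γ ^ 2 := by
    have hγ0 : γ ≠ 0 := hγ.ne'
    field_simp
    linear_combination hyn + D * hγ2
  have hC1 : (d * digitWeight r g 1 : ℂ) = d := by rw [digitWeight_one, mul_one]
  -- B₀ = √B and C₁ = √D absorb the normalizations; the other scalars are read off from a₀ = B₀ρ₀u₀,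
  -- a₁ = B₀ρ₁v, b₀ = C₁τ₀u₁ and g a₁ = C₁τ₁v.
  refine ⟨u₀, u₁, v, α / s, β / s, γ / d, g * β / d, r, s, fun l => d * digitWeight r g l,
    ‖(α / s : ℂ)‖ ^ 2 / (1 - ‖(α / s : ℂ)‖ ^ 2), ?_, ?_, rfl, hu₀, hu₁, hv, hx0, ?_, ?_, ?_, ?_, ?_,
    ?_, ?_, ?_, ?_, ?_, ?_, ?_, ?_⟩
  · exact norm_pos_iff.mpr (div_ne_zero hαc hsc)
  · have h1 : 0 < D / B := by positivity
    rw [← hρ1] at h1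
    nlinarith [norm_nonneg (α / s : ℂ)]
  · rw [hκ, ey]
    push_cast
    field_simp
    -- Eliminating r and g: ⟨a₁, a₀⟩⟨a₀, b₀⟩ and -D⟨a₁, b₀⟩ are both D² r conj(g).
    have : (β : ℂ) * γ * (α ^ 2 * conj (ip u₁ u₀) * ip v u₀ + D * ip v u₁) = 0 := by
      linear_combination (β * α * ip v u₀) * hy' - (D * conj g) * hx + D * hz
    have := (mul_eq_zero.mp this).resolve_left (mul_ne_zero hβc hγc)
    linear_combination this
  · rw [hκ, hX, hρ1, norm_div, div_pow, Complex.norm_real, Complex.norm_real, Real.norm_eq_abs,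
      sq_abs, Real.norm_eq_abs, sq_abs, hs2]
    have hβ0 : β ≠ 0 := hβ.ne'
    field_simp
  · rw [hκ, hY, norm_div, div_pow, Complex.norm_real, Complex.norm_real, Real.norm_eq_abs,
      sq_abs, Real.norm_eq_abs, sq_abs, hd2]
    have hγ0 : γ ≠ 0 := hγ.ne'
    field_simp
  · rw [hκ, hX]
    simp only [map_div₀, Complex.conj_ofReal]
    push_cast
    field_simp
    linear_combination hx
  · rw [ex] at hx0 ⊢
    rw [ez]
    field_simp
    have : (β : ℂ) * (g * α * conj (ip v u₀) - γ * conj (ip v u₁)) = 0 := by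
      linear_combination g * hx' - hz'
    have := (mul_eq_zero.mp this).resolve_left hβc
    linear_combination this
  · rw [Complex.norm_real, Real.norm_eq_abs, sq_abs, hs2]
  · simp only [hC1]
    rw [Complex.norm_real, Real.norm_eq_abs, sq_abs, hd2, hρ1]
    field_simp
  · intro p _
    simp only [hC1]
    rw [digitWeight_two_pow, hρ1, Complex.conj_ofReal]
    push_cast
    rw [← hs2c, ← hd2c]
    field_simp
  · intro p hp
    obtain ⟨k, rfl⟩ : ∃ k, p = k + 1 := ⟨p - 1, by omega⟩
    have := digitWeight_two_pow_add r g k (m := 1) le_rfl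
    rw [Nat.log_one_right, zero_add, digitWeight_one, one_mul] at this
    simp only [hC1]
    rw [this, hρ1, Complex.conj_ofReal, Complex.conj_ofReal, Nat.add_sub_cancel]
    push_cast
    rw [← hs2c, ← hd2c]
    field_simp
  · refine (productRule_iff (by simp only [hC1]; exact hdc)).mpr fun m k hm => ?_
    have := digitWeight_two_pow_add r g k (m := 1) le_rfl
    rw [Nat.log_one_right, zero_add, digitWeight_one, one_mul] at this
    simp only [hC1]
    rw [digitWeight_two_pow_add _ _ _ hm, this]
    field_simp
  · refine R.eq_zero.congr fun ω _ => ?_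
    simp only [smul_add, smul_smul]
    congr 2
    · field_simp
    · field_simp
  · refine R.eq_one.congr fun ω _ => ?_
    simp only [hC1, smul_add, smul_smul]
    congr 2
    · field_simp
    · field_simp
  · intro l hl
    simp only [hC1]
    rw [R.eq_smul l hl, mul_div_cancel_left₀ _ hdc]

end Parametrize

/-! ### From the types back to (h1). -/

section Realize

variable {B : ℝ} {h : ℕ → Hardy}

/-- Here D = 0, so there is no colligation to use; instead Ψ_l = 0 for l ≥ 2 and the recursion
propagates β_{1,1} = 0 to all l, l' ≥ 1. -/
theorem IsType1.condH1 (H : IsType1 B h) : CondH1 B h := by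
  obtain ⟨u, b, hu, hb, h0, hl⟩ := H
  have htaylor := (eqFun_geometric_iff (h 0) (b • u) 0 (r := 0) (by simp)).mp
    (h0.congr fun ω _ => by rw [smul_zero, add_zero])
  have hpsi1 : Psi h 1 = b • u := by rw [← htaylor.1, ← Psi_two_pow h 0, pow_zero]
  have hnorm : ‖b • u‖ ^ 2 = B := by rw [norm_smul, hu, mul_one, hb]
  have htz : ∀ k, taylor (0 : Hardy) k = 0 := fun k => by
    rw [← zero_smul ℂ (0 : Hardy), taylor_smul, zero_smul]
  have hpsi : ∀ l, 2 ≤ l → Psi h l = 0 := by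
    intro l hl2
    rcases eq_two_pow_or_eq_add hl2 with ⟨p, rfl⟩ | ⟨m, k, hm, rfl⟩
    · rw [Psi_two_pow, htaylor.2, smul_zero]
    · rw [Psi_add h m k hm, hl m hm, htz]
  have hbeta : ∀ l l', 1 ≤ l → 1 ≤ l' → beta B h l l' = 0 := by
    intro l
    induction l using Nat.strong_induction_on with
    | _ l ih =>
    intro l' h1 h2
    rcases h1.eq_or_lt with h3 | h3 <;> rcases h2.eq_or_lt with h4 | h4
    · rw [← h3, ← h4, beta_one_one, hpsi1, hnorm, sub_self, Complex.ofReal_zero]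
    · rw [← h3, ← beta_conj, beta_one_right B h h4, hpsi l' h4, ip_zero_right]; simp
    · rw [← h4, beta_one_right B h h3, hpsi l h3, ip_zero_right, neg_zero]
    · rw [beta_of_two_le B h h3 h4, hpsi l h3, ip_zero_right,
        ih _ (dropSecond_lt h3) _ (one_le_dropSecond l) (one_le_dropSecond l')]
      simp
  rw [condH1_iff]
  intro l l'
  rcases Nat.eq_zero_or_pos l with h1 | h1 <;> rcases Nat.eq_zero_or_pos l' with h2 | h2
  · subst h1; subst h2
    filter_upwards [h0] with t ht
    rw [ht, beta_zero_zero, ip_self, hnorm]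
  · subst h1
    filter_upwards [bd_zero] with t ht
    rw [hl l' h2, ht, ip_zero_left, beta_zero_left B h h2]
  · subst h2
    filter_upwards [bd_zero] with t ht
    rw [hl l h1, ht, ip_zero_right, beta_zero_right B h h1]
  · filter_upwards [bd_zero] with t ht
    rw [hl l h1, ht, ip_zero_right, hbeta l l' h1 h2]

theorem IsType2.condH1 (hB : 0 < B) (H : IsType2 B h) : CondH1 B h := by
  obtain ⟨u₀, u₁, b, c, ⟨hu₀, hu₁, huu⟩, hb, hc, h0, h1, hl⟩ := H
  refine condH1_of_realization (D := B) (a₀ := 0) (a₁ := b • u₀) (b₀ := c • u₁) (r := 0) (g := 0)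
    { pos := hB
      norm_a₀ := by simp
      norm_a₁ := by rw [norm_smul, hu₀, mul_one, hb]; simp
      norm_b₀ := by rw [norm_smul, hu₁, mul_one, hc]; simp
      ip_a₁_a₀ := by rw [ip_zero_right]; simp
      ip_b₀_a₀ := by rw [ip_zero_right]; simp
      ip_a₁_b₀ := by rw [ip_smul_left, ip_smul_right, huu]; simp }
    ⟨h0.congr fun ω _ => ?_, h1.congr fun ω _ => ?_, fun l hl1 => ?_⟩
  · rw [tsum_geometric_zero, zero_add]
  · rw [zero_smul, smul_zero, add_zero]
  · rcases hl1.eq_or_lt with h2 | h2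
    · rw [← h2, digitWeight_one, one_smul]
    · rw [hl l h2, digitWeight_zero_zero h2, zero_smul]

theorem IsType3.condH1 (hB : 0 < B) (H : IsType3 B h) : CondH1 B h := by
  obtain ⟨u₀, u₁, ρ, θ, b, c, ⟨hu₀, hu₁, huu⟩, hρ0, hρ1, hb, hc, h0, h1, hp, hl⟩ := H
  have hq : 0 < 1 - ρ ^ 2 := by nlinarith
  have hσ0 : 0 < √(1 - ρ ^ 2) := Real.sqrt_pos.mpr hq
  have hσ2 : √(1 - ρ ^ 2) ^ 2 = 1 - ρ ^ 2 := Real.sq_sqrt hq.le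
  have hEn : ‖Complex.exp (θ * Complex.I)‖ = 1 := Complex.norm_exp_ofReal_mul_I θ
  generalize √(1 - ρ ^ 2) = σ at *
  generalize Complex.exp (θ * Complex.I) = E at *
  rw [← hσ2] at hc
  have hbc := ofReal_norm_sq hb
  have hcc := ofReal_norm_sq hc
  push_cast at hcc
  have hD : 0 < B * σ ^ 2 := by positivity
  have hBc : (B : ℂ) ≠ 0 := by exact_mod_cast hB.ne'
  have hσc : (σ : ℂ) ≠ 0 := by exact_mod_cast hσ0.ne'
  have hc0 : conj c ≠ 0 := by
    intro h0
    rw [h0, mul_zero] at hcc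
    exact mul_ne_zero hBc (pow_ne_zero 2 hσc) hcc.symm
  have hu₀1 : ip u₀ u₀ = 1 := by rw [ip_self, hu₀]; simp
  have huu' : ip u₁ u₀ = 0 := by rw [← ip_conj, huu, map_zero]
  have hgn : ‖-(conj b * ρ * σ * E) / conj c‖ ^ 2 = ρ ^ 2 := by
    rw [norm_div, norm_neg, norm_mul, norm_mul, norm_mul, hEn, RCLike.norm_conj, RCLike.norm_conj,
      Complex.norm_real, Complex.norm_real, div_pow, hc, mul_one, mul_pow, mul_pow, hb,
      Real.norm_eq_abs, sq_abs, Real.norm_eq_abs, sq_abs]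
    field_simp
  -- g is the base of the power in the formula for `h (2 ^ p - 1)`, that is, the weight of 3.
  refine condH1_of_realization (D := B * σ ^ 2) (a₀ := (b * ρ) • u₀) (a₁ := (b * σ) • u₁)
    (b₀ := (c * E * σ) • u₀) (r := 0) (g := -(conj b * ρ * σ * E) / conj c)
    { pos := hD
      norm_a₀ := by
        rw [norm_smul, hu₀, mul_one, norm_mul, mul_pow, hb, Complex.norm_real, Real.norm_eq_abs,
          sq_abs, hσ2]
        ring
      norm_a₁ := by
        rw [norm_smul, hu₁, mul_one, norm_mul, mul_pow, hb, Complex.norm_real, Real.norm_eq_abs,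
          sq_abs]
        simp
      norm_b₀ := by
        rw [hgn, norm_smul, hu₀, mul_one, norm_mul, norm_mul, hEn, mul_one, mul_pow, hc,
          Complex.norm_real, Real.norm_eq_abs, sq_abs, ← hσ2]
      ip_a₁_a₀ := by rw [ip_smul_left, ip_smul_right, huu']; simp
      ip_b₀_a₀ := by
        rw [ip_smul_left, ip_smul_right, hu₀1]
        push_cast
        simp only [map_mul, Complex.conj_ofReal]
        rw [← hcc]
        field_simp
      ip_a₁_b₀ := by rw [ip_smul_left, ip_smul_right, ← ip_conj, huu]; simp }
    ⟨h0.congr fun ω _ => ?_, h1.congr fun ω _ => ?_, fun l hl1 => ?_⟩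
  · rw [tsum_geometric_zero]
    simp only [smul_add, smul_smul]
    congr 2
    ring
  · rw [tsum_geometric_zero]
    simp only [sub_eq_add_neg, smul_add, ← neg_smul, smul_smul]
    congr 2
    field_simp
    linear_combination (ρ * E * ω : ℂ) * (-hcc + σ ^ 2 * hbc)
  · by_cases hx : ∃ p, l = 2 ^ p - 1
    · obtain ⟨p, rfl⟩ := hx
      rcases p with _ | _ | q
      · simp at hl1
      · simp [digitWeight_one]
      · refine (hp (q + 1 + 1) (by omega)).unique ?_
        rw [digitWeight_zero_left_two_pow_sub_one]
        refine (h1.smul _).congr fun ω _ => ?_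
        rw [smul_smul, Nat.add_sub_cancel, mul_assoc _ c E]
    · push Not at hx
      rw [hl l hl1 hx, digitWeight_zero_left_of_ne _ hl1 hx, zero_smul]

theorem IsType4.condH1 (hB : 0 < B) (H : IsType4 B h) : CondH1 B h := by
  obtain ⟨u₀, u₁, ρ, θ, b, c, ⟨hu₀, hu₁, huu⟩, hρ0, hρ1, hb, hc, h0, h1, hp, hl⟩ := H
  have hq : 0 < 1 - ρ ^ 2 := by nlinarith
  have hEn : ‖Complex.exp (θ * Complex.I)‖ = 1 := Complex.norm_exp_ofReal_mul_I θ
  generalize Complex.exp (θ * Complex.I) = E at *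
  have hbc := ofReal_norm_sq hb
  have hcc := ofReal_norm_sq hc
  push_cast at hcc
  have hD : 0 < B * (1 - ρ ^ 2) := by positivity
  have hρc : (ρ : ℂ) ≠ 0 := by exact_mod_cast hρ0.ne'
  have hc0 : conj c ≠ 0 := by
    intro h0
    rw [h0, mul_zero] at hcc
    have : ((B * (1 - ρ ^ 2) : ℝ) : ℂ) ≠ 0 := by exact_mod_cast hD.ne'
    push_cast at this
    exact this hcc.symm
  have hu₀1 : ip u₀ u₀ = 1 := by rw [ip_self, hu₀]; simp
  have huu' : ip u₁ u₀ = 0 := by rw [← ip_conj, huu, map_zero]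
  have hrn : ‖-(ρ * E)‖ = ρ := by
    rw [norm_neg, norm_mul, hEn, Complex.norm_real, Real.norm_eq_abs, abs_of_pos hρ0, mul_one]
  refine condH1_of_realization (D := B * (1 - ρ ^ 2)) (a₀ := (b * ρ) • u₀)
    (a₁ := (b * (1 - ρ ^ 2 : ℝ) * E) • u₀) (b₀ := c • u₁) (r := -(ρ * E)) (g := 0)
    { pos := hD
      norm_a₀ := by
        rw [norm_smul, hu₀, mul_one, norm_mul, mul_pow, hb, Complex.norm_real, Real.norm_eq_abs,
          sq_abs]
        ring
      norm_a₁ := by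
        rw [hrn, norm_smul, hu₀, mul_one, norm_mul, norm_mul, hEn, mul_one, mul_pow, hb,
          Complex.norm_real, Real.norm_eq_abs, sq_abs]
        ring
      norm_b₀ := by rw [norm_smul, hu₁, mul_one, hc]; simp
      ip_a₁_a₀ := by
        rw [ip_smul_left, ip_smul_right, hu₀1]
        push_cast
        simp only [map_mul, Complex.conj_ofReal]
        linear_combination ((1 - ρ ^ 2) * E * ρ : ℂ) * hbc
      ip_b₀_a₀ := by rw [ip_smul_left, ip_smul_right, huu']; simp
      ip_a₁_b₀ := by rw [ip_smul_left, ip_smul_right, huu]; simp }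
    ⟨h0.congr fun ω _ => ?_, h1.congr fun ω _ => ?_, fun l hl1 => ?_⟩
  · generalize (∑' k : ℕ, ω ^ (k + 1) * (-(ρ * E)) ^ k) = S
    rw [smul_smul, smul_smul, ← add_smul]
    congr 1
    push_cast
    field_simp
  · rw [zero_smul, smul_zero, add_zero]
  · by_cases hx : ∃ p, l = 2 ^ p
    · obtain ⟨p, rfl⟩ := hx
      rcases Nat.eq_zero_or_pos p with hp0 | hp0
      · subst hp0
        rw [pow_zero, digitWeight_one, one_smul]
      · refine (hp p hp0).unique ?_
        rw [digitWeight_two_pow]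
        refine (h1.smul _).congr fun ω _ => ?_
        rw [smul_smul]
        congr 1
        -- Because |C₁|² = B(1 - ρ²), the prescribed coefficient of `h (2 ^ p)` is C₁ r ^ p with r =
        -- -ρ e^{iθ}.
        have hBc : (B : ℂ) / conj c * (1 - ρ ^ 2) = c := by
          rw [div_mul_eq_mul_div, div_eq_iff hc0, hcc]
        linear_combination -(-(ρ * E : ℂ)) ^ p * hBc
    · push Not at hx
      rw [hl l hl1 hx, digitWeight_zero_right_of_ne _ hl1 hx, zero_smul]

theorem IsType5.condH1 (hB : 0 < B) (H : IsType5 B h) : CondH1 B h := by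
  obtain ⟨u₀, u₁, v, ρ₀, ρ₁, τ₀, τ₁, r, b, C, κ, hρ0, hρ1, hκ, hu₀, hu₁, hv, hx0, hzx, hρ₁, hτ₀,
    hr, hτ₁, hb, hC1, hCp, hCa, hprod, h0, h1, hl⟩ := H
  have hq : 0 < 1 - ‖ρ₀‖ ^ 2 := by nlinarith
  have hκ0 : 0 < κ := by rw [hκ]; positivity
  have hκq : κ * (1 - ‖ρ₀‖ ^ 2) = ‖ρ₀‖ ^ 2 := by rw [hκ]; field_simp
  have hX0 : 0 < 1 + κ * ‖ip v u₀‖ ^ 2 := by positivity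
  have hY0 : 0 < 1 + κ * ‖ip u₁ u₀‖ ^ 2 := by positivity
  have hD : 0 < B * (1 - ‖ρ₀‖ ^ 2) := by positivity
  have ex : ip u₀ v = conj (ip v u₀) := (ip_conj _ _).symm
  have ey : ip u₀ u₁ = conj (ip u₁ u₀) := (ip_conj _ _).symm
  have ez : ip u₁ v = conj (ip v u₁) := (ip_conj _ _).symm
  have hz : ip v u₁ = -(κ * conj (ip u₁ u₀) * ip v u₀) := by
    rw [ey] at hzx; linear_combination hzx
  have hρ₀0 : ρ₀ ≠ 0 := norm_pos_iff.mp hρ0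
  have hρ₁0 : ρ₁ ≠ 0 := by
    intro hz
    have : 0 < ‖ρ₁‖ ^ 2 := by rw [hρ₁]; positivity
    rw [hz] at this
    simp at this
  have hb0 : b ≠ 0 := by
    intro hz
    rw [hz] at hb
    simp at hb
    exact hB.ne hb
  have hC0 : C 1 ≠ 0 := by
    intro hz
    rw [hz] at hC1
    rw [← hC1] at hD
    simp at hD
  have hx0' : conj (ip v u₀) ≠ 0 := by rwa [← ex]
  -- Chosen so that g a₁ = C₁τ₁v. The relation between u₀, u₁, v turns it into the form `hgκ`, free
  -- of ρ₁ and v, from which |g| and ⟨b₀, a₀⟩ are computed.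
  set g : ℂ := C 1 * τ₁ / (b * ρ₁) with hg
  have hgκ : g = -(C 1 * τ₀ * κ * ip u₁ u₀) / (b * ρ₀) := by
    rw [hg, hτ₁, ez, ex, hz]
    simp only [map_neg, map_mul, Complex.conj_ofReal, Complex.conj_conj]
    field_simp
  have hrn : 1 - ‖r‖ ^ 2 = (1 + κ * ‖ip v u₀‖ ^ 2)⁻¹ := by
    rw [hr, norm_mul, norm_neg, norm_div, norm_div, RCLike.norm_conj, RCLike.norm_conj,
      Complex.norm_real, mul_pow, div_pow, div_pow, hρ₁, Real.norm_eq_abs, sq_abs]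
    generalize 1 - ‖ρ₀‖ ^ 2 = q at hκq hq ⊢
    rw [← hκq]
    field_simp
    ring
  have hgn : 1 - ‖g‖ ^ 2 = ‖τ₀‖ ^ 2 := by
    have hρn : ‖ρ₀‖ ^ 2 ≠ 0 := by positivity
    have e1 : ‖g‖ ^ 2 = κ * ‖ip u₁ u₀‖ ^ 2 * ‖τ₀‖ ^ 2 := by
      rw [hgκ, norm_div, norm_neg, norm_mul, norm_mul, norm_mul, norm_mul, div_pow, mul_pow,
        mul_pow, mul_pow, mul_pow, hb, hC1, Complex.norm_real, Real.norm_eq_abs, sq_abs,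
        div_eq_iff (by positivity)]
      linear_combination (B * κ * ‖ip u₁ u₀‖ ^ 2 * ‖τ₀‖ ^ 2) * hκq
    rw [e1, hτ₀]
    field_simp
    ring
  have hbc := ofReal_norm_sq hb
  have hCc := ofReal_norm_sq hC1
  have hρc : ρ₀ * conj ρ₀ = ((‖ρ₀‖ ^ 2 : ℝ) : ℂ) := (norm_sq_eq ρ₀).symm
  have hρ₁c := ofReal_norm_sq hρ₁
  have hX0c : ((1 + κ * ‖ip v u₀‖ ^ 2 : ℝ) : ℂ) ≠ 0 := by exact_mod_cast hX0.ne'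
  have hκqc : (κ : ℂ) * ((1 - ‖ρ₀‖ ^ 2 : ℝ) : ℂ) = ρ₀ * conj ρ₀ := by
    rw [hρc]; exact_mod_cast hκq
  have hρ₀0' : conj ρ₀ ≠ 0 := (map_ne_zero _).mpr hρ₀0
  have hρ₁0' : conj ρ₁ ≠ 0 := (map_ne_zero _).mpr hρ₁0
  have hb0' : conj b ≠ 0 := (map_ne_zero _).mpr hb0
  have hC0' : conj (C 1) ≠ 0 := (map_ne_zero _).mpr hC0
  have hDr : ((B * (1 - ‖ρ₀‖ ^ 2) : ℝ) : ℂ) * r = -(b * ρ₁ * conj b * conj ρ₀ * ip v u₀) := by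
    rw [Complex.ofReal_mul, ← hbc, hr]
    rw [Complex.ofReal_div, eq_div_iff hX0c] at hρ₁c
    rw [← hρ₁c]
    field_simp
  rw [Complex.ofReal_mul] at hCc hDr
  have hC2 : ∀ p, C (2 ^ p) / C 1 = r ^ p := by
    intro p
    rcases Nat.eq_zero_or_pos p with hp | hp
    · rw [hp, pow_zero, pow_zero, div_self hC0]
    · have hBC : (B : ℂ) / conj (C 1) * ((1 - ‖ρ₀‖ ^ 2 : ℝ) : ℂ) = C 1 := by
        rw [div_mul_eq_mul_div, div_eq_iff hC0', hCc]
      rw [hCp p hp, hBC, mul_div_cancel_left₀ _ hC0]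
  have hC3 : ∀ k, C (2 ^ (k + 1) + 1) / C 1 = g * r ^ k := by
    intro k
    have hbC : conj b / conj (C 1) * ((1 - ‖ρ₀‖ ^ 2 : ℝ) : ℂ) = C 1 / b := by
      rw [div_mul_eq_mul_div, div_eq_div_iff hC0' hb0]
      linear_combination ((1 - ‖ρ₀‖ ^ 2 : ℝ) : ℂ) * hbc - hCc
    calc C (2 ^ (k + 1) + 1) / C 1
        = conj b / conj (C 1) * ((1 - ‖ρ₀‖ ^ 2 : ℝ) : ℂ) * (τ₁ / ρ₁) * r ^ k := by
          rw [hCa (k + 1) (by omega), Nat.add_sub_cancel, div_eq_iff hC0]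
          ring
      _ = g * r ^ k := by rw [hbC, hg]; field_simp
  refine condH1_of_realization (D := B * (1 - ‖ρ₀‖ ^ 2)) (a₀ := (b * ρ₀) • u₀)
    (a₁ := (b * ρ₁) • v) (b₀ := (C 1 * τ₀) • u₁) (r := r) (g := g)
    { pos := hD
      norm_a₀ := by
        rw [norm_smul, hu₀, mul_one, norm_mul, mul_pow, hb]
        ring
      norm_a₁ := by
        rw [norm_smul, hv, mul_one, norm_mul, mul_pow, hb, hrn, hρ₁]
        ring
      norm_b₀ := by
        rw [norm_smul, hu₁, mul_one, norm_mul, mul_pow, hC1, hgn]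
      ip_a₁_a₀ := by
        rw [ip_smul_left, ip_smul_right, Complex.ofReal_mul, hDr]
        simp only [map_mul]
        ring
      ip_b₀_a₀ := by
        rw [ip_smul_left, ip_smul_right, Complex.ofReal_mul, hgκ]
        simp only [map_mul]
        rw [mul_div_assoc', ← neg_div, eq_div_iff (mul_ne_zero hb0 hρ₀0)]
        linear_combination (C 1 * τ₀ * ip u₁ u₀ * ρ₀ * conj ρ₀) * hbc
          - (C 1 * τ₀ * ip u₁ u₀ * B) * hκqc
      ip_a₁_b₀ := by
        rw [ip_smul_left, ip_smul_right, Complex.ofReal_mul, hDr, hz, hgκ]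
        simp only [map_mul, map_neg, map_div₀, Complex.conj_ofReal]
        field_simp }
    ⟨h0.congr fun ω _ => ?_, h1.congr fun ω _ => ?_, fun l hl1 => ?_⟩
  · generalize (∑' k : ℕ, ω ^ (k + 1) * r ^ k) = S
    simp only [smul_add, smul_smul]
    congr 2
    ring
  · generalize (∑' k : ℕ, ω ^ (k + 1) * r ^ k) = S
    simp only [smul_add, smul_smul]
    congr 2
    rw [hg]
    field_simp
  · rw [hl l hl1]
    congr 1
    -- The values at 2 ^ p and 2 ^ p + 1 and the product rule determine C_l / C₁ for all l ≥ 1, and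
    -- the weight satisfies the same recursion.
    refine eq_digitWeight (c := fun l => C l / C 1) hC2 (fun m k hm => ?_) hl1
    rw [(productRule_iff hC0).mp hprod m k hm, ← hC3]
    field_simp

end Realize

theorem proposition3p11 (B : ℝ) (hB : 0 < B) (h : ℕ → Hardy) :
    CondH1 B h ↔
      IsType1 B h ∨ IsType2 B h ∨ IsType3 B h ∨ IsType4 B h ∨ IsType5 B h := by
  constructor
  · intro H
    by_cases h11 : beta B h 1 1 = 0
    · exact Or.inl (H.isType1 hB h11)
    obtain ⟨D, a₀, a₁, b₀, r, g, hcol, hreal⟩ := H.exists_realization hB h11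
    by_cases ha : a₀ = 0
    · exact Or.inr (Or.inl (isType2_of_realization hcol hreal ha))
    -- No case distinction on g is needed: type 5 covers every r ≠ 0, including g = 0.
    by_cases hr : r = 0
    · exact Or.inr (Or.inr (Or.inl (isType3_of_realization hB hcol hreal ha hr)))
    · exact Or.inr (Or.inr (Or.inr (Or.inr (isType5_of_realization hB hcol hreal hr))))
  · rintro (H | H | H | H | H)
    · exact H.condH1
    · exact H.condH1 hB
    · exact H.condH1 hB
    · exact H.condH1 hB
    · exact H.condH1 hB

end
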